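/- **Setting.** A CSS code is a complex of based $\mathbb F_2$-vector spaces $C_\bullet=(C_1\xrightarrow{P_Z^{\top}}C_0\xrightarrow{P_X}C_{-1})$ together with its transpose $C_\bullet^*$; the basis of $C_0$ is the set of qubits and the bases of $C_{1}$, $C_{-1}$ are the $Z$- and $X$-checks. Write $Z_0(C)=\ker P_X$, $B_0(C)=\operatorname{im}P_Z^{\top}$, $H_0(C)=Z_0(C)/B_0(C)$. The distance is the least Hamming weight of an element of $\big(Z_0(C)\setminus B_0(C)\big)\cup\big(Z_0(C^*)\setminus B_0(C^*)\big)$. A basis of $H_0(C)$ (logical $\overline Z_l$) determines the dual basis of $H_0(C^*)$ (logical $\overline X_l$) and hence the logical qubits: the logical state $|a\rangle$ is the uniform superposition of the bit strings in the class $\sum_l a_l\overline X_l$. Let $(C_\bullet,C_\bullet^*)$ and $(D_\bullet,D_\bullet^*)$ be CSS codes with bases $([u]_k)_{k\in K_C}$ of $H_0(C)$ and $([v]_l)_{l\in K_D}$ of $H_0(D)$, and let $i\in K_C$, $j\in K_D$. Let $V_\bullet=(V_0\xrightarrow{\partial}V_{-1})$, with $\dim V_0=m$ and $\dim V_{-1}=r$,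 be a logical operator subcomplex of both codes: there are $u\in Z_0(C)\setminus B_0(C)$ and $v\in Z_0(D)\setminus B_0(D)$ and injective chain maps $f:V\to C$, $g:V\to D$ such that $f_0$ maps the basis of $V_0$ bijectively onto $\operatorname{supp}u$, $g_0$ maps it bijectively onto $\operatorname{supp}v$, and $V_{-1}=\operatorname{im}\partial$ (so that $f_{-1}$ and $g_{-1}$ identify $V_{-1}$ with the images of $\operatorname{supp} u$ and $\operatorname{supp} v$ under $P_X$; when $V_{-1}$ is spanned by $X$-checks, $r$ is the number of $X$-checks of each code meeting the operator). Assume: * *Separation.* $u\in[u]_i$ and $v\in[v]_j$; every $u'\in Z_0(C)\setminus B_0(C)$ with $\operatorname{supp}u'\subseteq\operatorname{supp}u$ lies in $[u]_i$, and every $v'\in Z_0(D)\setminus B_0(D)$ with $\operatorname{supp}v'\subseteq\operatorname{supp}v$ lies in $[v]_j$; and for every $s\in V_0$, $f_0(s)\in Z_0(C)\setminus B_0(C)$ if and only if $g_0(s)\in Z_0(D)\setminus B_0(D)$. * *Gauge-fixability.* For every qubit $p\in\operatorname{supp}u$ the class $\overline X_i$ of $C$ has a representative that meets $\operatorname{supp}u$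 exactly in $p$; likewise for every qubit of $\operatorname{supp}v$ and the class $\overline X_j$ of $D$. * *Distance bounded below.* Let $d$ be the distance of $C\oplus D$. Every element of $Z_0(T)\setminus B_0(T)$ has weight at least $d$, where $T$ is the sandwiched code, with $$T_1=C_1\oplus D_1\oplus V_0,\quad T_0=C_0\oplus D_0\oplus V_{-1},\quad T_{-1}=C_{-1}\oplus D_{-1},$$ $$\partial_0(c,c',s)=(\partial c+f_0s,\ \partial c'+g_0s,\ \partial s),\qquad \partial_{-1}(q,q',t)=(\partial q+f_{-1}t,\ \partial q'+g_{-1}t);$$ it is obtained from $W=(\mathbb F_2\xrightarrow{(1,1)^{\top}}\mathbb F_2^2)\otimes V$ by pushing out along $f$ on one copy of $V$ in $W$ and along $g$ on the other. **Claim.** $T$ has distance at least $d$, and the images in $H_0(T)$ of the classes $[u]_k$ ($k\in K_C$) and $[v]_l$ ($l\ne j$) form a basis of $H_0(T)$, with $[v]_j$ having the same image as $[u]_i$. Moreover there is a procedure of the following kind: start with the qubits of $C\oplus D$ and $r$ fresh qubits prepared in $|+\rangle$; measure all checks of $T$, which include $m$ $Z$-checks in addition to those of $C\oplus D$, in each of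 $d$ rounds; then, as functions of the recorded outcomes, report a bit $c$ and apply a Pauli correction; such that 1. (*Logical measurement.*) Without faults, on inputs in the code space of $C\oplus D$, the procedure is the measurement of $\overline Z_i\otimes\overline Z_j$ with output in the code space of $T$: for every record of outcomes the operator applied is a scalar times the logical branch of the reported bit $c$, and the squared moduli of the scalars of the records reporting $c$ sum to $1$ for each $c\in\{0,1\}$. The logical branch of $c$ projects on $\overline Z_i\overline Z_j=(-1)^c$, applies $\overline X_i^{\,c}$, maps logical qubits $i,j$ to one logical qubit by $|00\rangle\mapsto|0\rangle$, $|11\rangle\mapsto|1\rangle$, and is the identity on all other logical qubits. 2. (*Fault tolerance with distance $d$.*) An elementary fault is a single-qubit Pauli error on any qubit before the first round (including errors of the input and of the preparation of the fresh qubits) or after any round, or the flip of one recorded outcome. (a) If fewer than $d$ faults occur and the record is one that is possible without faults, then the operation performed is a scalar times the logical branch of the reported bit followed by a Pauli error on at most as many qubits as there were faults. (b) If fewer than $d/2$ faults occur, then for every record the operation performed is, on the logical space, the branch of the reported bit, and the output state is restored exactly by a Pauli correction depending only on the record and on the syndrome of one further faultless round of check measurements. -/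

import Mathlib

open scoped Matrix

noncomputable section

/-! ## CSS codes as length-two chain complexes over `𝔽₂` -/

/-- A CSS code `C₁ → C₀ → C₋₁` over `𝔽₂` with `∂₀ = P_Zᵀ` and `∂₋₁ = P_X`.  The based vector spaces
are `C₋₁ = 𝔽₂^X` (`X`-checks), `C₀ = 𝔽₂^Q` (qubits) and `C₁ = 𝔽₂^Z` (`Z`-checks). -/
@[ext] structure CSSCode (X Q Z : Type*) [Fintype Q] where
  PX : Matrix X Q (ZMod 2)
  PZ : Matrix Z Q (ZMod 2)
  comm : PX * PZᵀ = 0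

namespace CSSCode

variable {X Q Z : Type*} [Fintype X] [Fintype Q] [Fintype Z]

/-- The dual code, with the roles of `X` and `Z` exchanged. -/
def dual (C : CSSCode X Q Z) : CSSCode Z Q X where
  PX := C.PZ
  PZ := C.PX
  comm := by
    have h := congrArg Matrix.transpose C.comm
    simpa [Matrix.transpose_mul] using h

/-- `Z₀(C) = ker ∂₋₁`: the `Z`-operators commuting with all `X`-checks. -/
def cycles (C : CSSCode X Q Z) : Submodule (ZMod 2) (Q → ZMod 2) :=
  LinearMap.ker C.PX.mulVecLin

/-- `B₀(C) = im ∂₀`: the products of `Z`-checks. -/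
def boundaries (C : CSSCode X Q Z) : Submodule (ZMod 2) (Q → ZMod 2) :=
  LinearMap.range C.PZᵀ.mulVecLin

/-- The homology `H₀(C) = Z₀(C) / B₀(C)`, the space of logical `Z`-operators. -/
abbrev H0 (C : CSSCode X Q Z) : Type _ :=
  ↥C.cycles ⧸ C.boundaries.comap C.cycles.subtype

/-- `z` is a cycle in the homology class `h`. -/
def Represents (C : CSSCode X Q Z) (z : Q → ZMod 2) (h : C.H0) : Prop :=
  ∃ hz : z ∈ C.cycles, (Submodule.Quotient.mk ⟨z, hz⟩ : C.H0) = h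

/-- `z` is a nontrivial logical `Z`-operator: an element of `Z₀(C) \ B₀(C)`. -/
def IsLogicalZ (C : CSSCode X Q Z) (z : Q → ZMod 2) : Prop :=
  z ∈ C.cycles ∧ z ∉ C.boundaries

/-- The code distance: the least weight of a nontrivial logical `Z`- or `X`-operator. -/
def distance (C : CSSCode X Q Z) : ℕ :=
  sInf {w | ∃ v, (C.IsLogicalZ v ∨ C.dual.IsLogicalZ v) ∧ hammingNorm v = w}

/-- For a basis `b` of `H₀(C)` and a bit string `a`, the class in `H₀(C*)` (as a set of
representatives) whose pairing with the basis vector `b l` is `a l` for every `l`.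
For `a = Pi.single i 1` it is the `i`-th vector of the basis of `H₀(C*)` dual to `b`,
that is, the logical operator `X̄ᵢ`. -/
def xClass (C : CSSCode X Q Z) {K : Type*} (b : Module.Basis K (ZMod 2) C.H0)
    (a : K → ZMod 2) : Set (Q → ZMod 2) :=
  {q | q ∈ C.dual.cycles ∧ ∀ l z, C.Represents z (b l) → z ⬝ᵥ q = a l}

/-- The isometry from logical to physical qubits of the based code `(C, b)`: the logical
computational basis state `|a⟩` is the uniform superposition of the strings in `xClass b a`. -/
def encoder (C : CSSCode X Q Z) {K : Type*} (b : Module.Basis K (ZMod 2) C.H0) :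
    Matrix (Q → ZMod 2) (K → ZMod 2) ℂ :=
  open scoped Classical in
  Matrix.of fun q a =>
    if q ∈ C.xClass b a then (((Real.sqrt ((C.xClass b a).ncard : ℝ))⁻¹ : ℝ) : ℂ) else 0

/-- The direct sum of two codes, acting in parallel on disjoint sets of qubits. -/
def directSum {X' Q' Z' : Type*} [Fintype Q'] (C : CSSCode X Q Z) (D : CSSCode X' Q' Z') :
    CSSCode (X ⊕ X') (Q ⊕ Q') (Z ⊕ Z') where
  PX := Matrix.fromBlocks C.PX 0 0 D.PX
  PZ := Matrix.fromBlocks C.PZ 0 0 D.PZ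
  comm := by
    simp [Matrix.fromBlocks_transpose, Matrix.fromBlocks_multiply, C.comm, D.comm]

end CSSCode

/-! ## Logical operator subcomplexes, separation, gauge-fixability -/

/-- The length-one complex `V₀ → V₋₁` with differential `dV`, all other components being zero. -/
def CSSCode.ofDifferential {R M : Type*} [Fintype M] (dV : Matrix R M (ZMod 2)) :
    CSSCode R M Empty where
  PX := dV
  PZ := 0
  comm := by simp

/-- `V = (dV : V₀ → V₋₁)` is, via the given inclusions, the logical operator subcomplex of `C`
for the nontrivial logical operator `op`: the basis of `V₀` is `supp op`, the differential is the
restriction of `∂₋₁` to `supp op`, and `V₋₁` is the image of this restriction. -/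
structure LogicalSubcomplex {X Q Z R M : Type*} [Fintype X] [Fintype Q] [Fintype Z] [Fintype R]
    [Fintype M] (C : CSSCode X Q Z) (dV : Matrix R M (ZMod 2)) where
  op : Q → ZMod 2
  isLogicalZ : C.IsLogicalZ op
  /-- the inclusion of the basis of `V₀` -/
  emb : M ↪ Q
  range_emb : Set.range emb = {q | op q ≠ 0}
  /-- the matrix of the inclusion `V₋₁ ↪ C₋₁` -/
  incl : Matrix X R (ZMod 2)
  incl_injective : Function.Injective incl.mulVec
  restrict : incl * dV = C.PX.submatrix id emb
  surjective : LinearMap.range dV.mulVecLin = ⊤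

namespace LogicalSubcomplex

variable {X Q Z R M : Type*} [Fintype X] [Fintype Q] [Fintype Z] [Fintype R] [Fintype M]
  [DecidableEq Q] {C : CSSCode X Q Z} {dV : Matrix R M (ZMod 2)}

/-- The matrix of the inclusion `V₀ ↪ C₀`. -/
def incl₀ (S : LogicalSubcomplex C dV) : Matrix Q M (ZMod 2) :=
  Matrix.of fun q k => if S.emb k = q then 1 else 0

lemma PX_mul_incl₀ (S : LogicalSubcomplex C dV) : C.PX * S.incl₀ = S.incl * dV := by
  rw [S.restrict]
  ext x k
  simp [Matrix.mul_apply, incl₀]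

/-- The operator is gauge-fixable, for logical qubit `i`: every qubit `p` of its support is safely
correctable, by a representative of `X̄ᵢ` meeting the support exactly in `p`. -/
def GaugeFixable (S : LogicalSubcomplex C dV) {K : Type*} [DecidableEq K]
    (b : Module.Basis K (ZMod 2) C.H0) (i : K) : Prop :=
  ∀ p, S.op p ≠ 0 → ∃ v ∈ C.xClass b (Pi.single i 1),
    v p = 1 ∧ ∀ y, S.op y ≠ 0 → y ≠ p → v y = 0

end LogicalSubcomplex

/-- `V` is a separated logical operator subcomplex of `C` and `D`, acting on logical qubit `i` of
the based code `(C, bC)` and logical qubit `j` of `(D, bD)`. -/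
structure Separated {XC QC ZC XD QD ZD R M KC KD : Type*}
    [Fintype XC] [Fintype QC] [Fintype ZC] [Fintype XD] [Fintype QD] [Fintype ZD]
    [Fintype R] [Fintype M] [DecidableEq QC] [DecidableEq QD]
    {C : CSSCode XC QC ZC} {D : CSSCode XD QD ZD} {dV : Matrix R M (ZMod 2)}
    (bC : Module.Basis KC (ZMod 2) C.H0) (bD : Module.Basis KD (ZMod 2) D.H0) (i : KC) (j : KD)
    (S : LogicalSubcomplex C dV) (S' : LogicalSubcomplex D dV) : Prop where
  class_left : C.Represents S.op (bC i)
  class_right : D.Represents S'.op (bD j)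
  only_left : ∀ u, C.IsLogicalZ u → (∀ q, u q ≠ 0 → S.op q ≠ 0) → C.Represents u (bC i)
  only_right : ∀ v, D.IsLogicalZ v → (∀ q, v q ≠ 0 → S'.op q ≠ 0) → D.Represents v (bD j)
  iff : ∀ s : M → ZMod 2, C.IsLogicalZ (S.incl₀ *ᵥ s) ↔ D.IsLogicalZ (S'.incl₀ *ᵥ s)

/-! ## The sandwiched code -/

section Sandwich

variable {XC QC ZC XD QD ZD R M : Type*}
  [Fintype XC] [Fintype QC] [Fintype ZC] [Fintype XD] [Fintype QD] [Fintype ZD]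
  [Fintype R] [Fintype M] [DecidableEq QC] [DecidableEq QD]
  {C : CSSCode XC QC ZC} {D : CSSCode XD QD ZD} {dV : Matrix R M (ZMod 2)}

/-- The sandwiched code `T`, with `T₁ = C₁ ⊕ D₁ ⊕ V₀`, `T₀ = C₀ ⊕ D₀ ⊕ V₋₁`, `T₋₁ = C₋₁ ⊕ D₋₁`.
It is the iterated pushout of `C`, `W = P ⊗ V` and `D` along the two copies of `V` in `W`; see
`sandwich_isPushout` below. -/
def sandwich (S : LogicalSubcomplex C dV) (S' : LogicalSubcomplex D dV) :
    CSSCode (XC ⊕ XD) ((QC ⊕ QD) ⊕ R) ((ZC ⊕ ZD) ⊕ M) where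
  PX := Matrix.fromCols (C.directSum D).PX (Matrix.fromRows S.incl S'.incl)
  PZ := Matrix.fromBlocks (C.directSum D).PZ 0 (Matrix.fromCols S.incl₀ᵀ S'.incl₀ᵀ) dVᵀ
  comm := by
    have h2 : ∀ {m n : Type _} (A : Matrix m n (ZMod 2)), A + A = 0 := fun A => by
      ext; exact CharTwo.add_self_eq_zero _
    rw [Matrix.fromBlocks_transpose, Matrix.fromCols_mul_fromBlocks, (C.directSum D).comm]
    simp only [Matrix.transpose_zero, Matrix.mul_zero, add_zero, Matrix.transpose_transpose,
      Matrix.transpose_fromCols, CSSCode.directSum, Matrix.fromBlocks_mul_fromRows,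
      Matrix.zero_mul, zero_add, S.PX_mul_incl₀, S'.PX_mul_incl₀, Matrix.fromRows_mul]
    rw [h2]
    ext a (b | b) <;> simp

end Sandwich

/-! ## The sandwiched code is the pushout of a pushout -/


section Pushout

variable {XC QC ZC XD QD ZD R M : Type*}
  [Fintype XC] [Fintype QC] [Fintype ZC] [Fintype XD] [Fintype QD] [Fintype ZD]
  [Fintype R] [Fintype M]

/-- Chain maps of length-two complexes. -/
@[ext] structure CSSHom {X Q Z X' Q' Z' : Type*} [Fintype X] [Fintype Q] [Fintype Z] [Fintype X']
    [Fintype Q'] [Fintype Z'] (C : CSSCode X Q Z) (D : CSSCode X' Q' Z') where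
  deg1 : Matrix Z' Z (ZMod 2)
  deg0 : Matrix Q' Q (ZMod 2)
  degm : Matrix X' X (ZMod 2)
  comm0 : deg0 * C.PZᵀ = D.PZᵀ * deg1
  commm : degm * C.PX = D.PX * deg0

/-- Composition of chain maps, `g` after `f`. -/
def CSSHom.comp {X Q Z X' Q' Z' X'' Q'' Z'' : Type*} [Fintype X] [Fintype Q] [Fintype Z]
    [Fintype X'] [Fintype Q'] [Fintype Z'] [Fintype X''] [Fintype Q''] [Fintype Z'']
    {C : CSSCode X Q Z} {D : CSSCode X' Q' Z'} {E : CSSCode X'' Q'' Z''}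
    (g : CSSHom D E) (f : CSSHom C D) : CSSHom C E where
  deg1 := g.deg1 * f.deg1
  deg0 := g.deg0 * f.deg0
  degm := g.degm * f.degm
  comm0 := by rw [Matrix.mul_assoc, f.comm0, ← Matrix.mul_assoc, g.comm0, Matrix.mul_assoc]
  commm := by rw [Matrix.mul_assoc, f.commm, ← Matrix.mul_assoc, g.commm, Matrix.mul_assoc]

/-- The square `k ∘ f = l ∘ g` is a pushout square of chain complexes. -/
def IsCSSPushout.{u} {XA QA ZA X Q Z : Type*} [Fintype XA] [Fintype QA] [Fintype ZA]
    [Fintype X] [Fintype Q] [Fintype Z]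
    {A : CSSCode XA QA ZA} {C : CSSCode XC QC ZC} {D : CSSCode XD QD ZD} {P : CSSCode X Q Z}
    (f : CSSHom A C) (g : CSSHom A D) (k : CSSHom C P) (l : CSSHom D P) : Prop :=
  k.comp f = l.comp g ∧
    ∀ (X' Q' Z' : Type u) [Fintype X'] [Fintype Q'] [Fintype Z'] (E : CSSCode X' Q' Z')
      (k' : CSSHom C E) (l' : CSSHom D E), k'.comp f = l'.comp g →
        ∃! t : CSSHom P E, t.comp k = k' ∧ t.comp l = l'

/-- The inclusion of a logical operator subcomplex, as a chain map. -/
def LogicalSubcomplex.hom [DecidableEq QC] {C : CSSCode XC QC ZC} {dV : Matrix R M (ZMod 2)}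
    (S : LogicalSubcomplex C dV) : CSSHom (CSSCode.ofDifferential dV) C where
  deg1 := 0
  deg0 := S.incl₀
  degm := S.incl
  comm0 := by simp [CSSCode.ofDifferential]
  commm := S.PX_mul_incl₀.symm

variable [DecidableEq R] [DecidableEq M]

/-- The tensor product `W = P ⊗ V` with `P = (𝔽₂ → 𝔽₂²)`, where `W₁ = V₀`,
`W₀ = V₀ ⊕ V₀ ⊕ V₋₁` and `W₋₁ = V₋₁ ⊕ V₋₁`. -/
def middleCode (dV : Matrix R M (ZMod 2)) : CSSCode (R ⊕ R) ((M ⊕ M) ⊕ R) M where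
  PX := Matrix.fromCols (Matrix.fromBlocks dV 0 0 dV) (Matrix.fromRows 1 1)
  PZ := Matrix.fromCols (Matrix.fromCols 1 1) dVᵀ
  comm := by
    rw [Matrix.transpose_fromCols, Matrix.transpose_fromCols, Matrix.fromCols_mul_fromRows,
      Matrix.fromBlocks_mul_fromRows, Matrix.fromRows_mul]
    ext (a | a) b <;> simp [CharTwo.add_self_eq_zero]

/-- The inclusion of `V` as the first copy in `W`. -/
def middleInl (dV : Matrix R M (ZMod 2)) :
    CSSHom (CSSCode.ofDifferential dV) (middleCode dV) where
  deg1 := 0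
  deg0 := Matrix.fromRows (Matrix.fromRows 1 0) 0
  degm := Matrix.fromRows 1 0
  comm0 := by simp [CSSCode.ofDifferential]
  commm := by
    simp [CSSCode.ofDifferential, middleCode, Matrix.fromCols_mul_fromRows,
      Matrix.fromBlocks_mul_fromRows, Matrix.fromRows_mul]

/-- The inclusion of `V` as the second copy in `W`. -/
def middleInr (dV : Matrix R M (ZMod 2)) :
    CSSHom (CSSCode.ofDifferential dV) (middleCode dV) where
  deg1 := 0
  deg0 := Matrix.fromRows (Matrix.fromRows 0 1) 0
  degm := Matrix.fromRows 0 1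
  comm0 := by simp [CSSCode.ofDifferential]
  commm := by
    simp [CSSCode.ofDifferential, middleCode, Matrix.fromCols_mul_fromRows,
      Matrix.fromBlocks_mul_fromRows, Matrix.fromRows_mul]

variable [DecidableEq XC] [DecidableEq QC] [DecidableEq ZC] [DecidableEq XD] [DecidableEq QD]
  [DecidableEq ZD] {C : CSSCode XC QC ZC} {D : CSSCode XD QD ZD} {dV : Matrix R M (ZMod 2)}

/-- The first pushout `R`, of `C` and `W` along the first copy of `V`. -/
def halfSandwich (S : LogicalSubcomplex C dV) :
    CSSCode (XC ⊕ R) ((QC ⊕ M) ⊕ R) (ZC ⊕ M) where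
  PX := Matrix.fromCols (Matrix.fromBlocks C.PX 0 0 dV) (Matrix.fromRows S.incl 1)
  PZ := Matrix.fromBlocks (Matrix.fromCols C.PZ 0) 0 (Matrix.fromCols S.incl₀ᵀ 1) dVᵀ
  comm := by
    rw [Matrix.fromBlocks_transpose, Matrix.fromCols_mul_fromBlocks]
    simp only [Matrix.transpose_fromCols, Matrix.fromBlocks_mul_fromRows, Matrix.fromRows_mul,
      Matrix.transpose_transpose, S.PX_mul_incl₀, C.comm]
    ext (a | a) (b | b) <;> simp [CharTwo.add_self_eq_zero]

/-- The map `C → R`. -/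
def halfInl (S : LogicalSubcomplex C dV) : CSSHom C (halfSandwich S) where
  deg1 := Matrix.fromRows 1 0
  deg0 := Matrix.fromRows (Matrix.fromRows 1 0) 0
  degm := Matrix.fromRows 1 0
  comm0 := by
    simp [halfSandwich, Matrix.fromBlocks_transpose, Matrix.fromBlocks_mul_fromRows,
      Matrix.fromRows_mul, Matrix.transpose_fromCols]
  commm := by
    simp [halfSandwich, Matrix.fromCols_mul_fromRows,
      Matrix.fromBlocks_mul_fromRows, Matrix.fromRows_mul]

/-- The map `W → R`. -/
def halfInr (S : LogicalSubcomplex C dV) : CSSHom (middleCode dV) (halfSandwich S) where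
  deg1 := Matrix.fromRows 0 1
  deg0 := Matrix.fromBlocks (Matrix.fromBlocks S.incl₀ 0 0 1) 0 0 1
  degm := Matrix.fromBlocks S.incl 0 0 1
  comm0 := by
    simp [halfSandwich, middleCode, Matrix.fromBlocks_transpose, Matrix.fromBlocks_mul_fromRows,
      Matrix.transpose_fromCols]
  commm := by
    simp [halfSandwich, middleCode, Matrix.fromCols_mul_fromBlocks, Matrix.mul_fromCols,
      Matrix.fromBlocks_mul_fromRows, Matrix.fromBlocks_multiply, S.PX_mul_incl₀]

/-- The map `R → T`. -/
def sandwichInl (S : LogicalSubcomplex C dV) (S' : LogicalSubcomplex D dV) :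
    CSSHom (halfSandwich S) (sandwich S S') where
  deg1 := Matrix.fromBlocks (Matrix.fromRows 1 0) 0 0 1
  deg0 := Matrix.fromBlocks (Matrix.fromBlocks 1 0 0 S'.incl₀) 0 0 1
  degm := Matrix.fromBlocks 1 0 0 S'.incl
  comm0 := by
    simp [halfSandwich, sandwich, CSSCode.directSum, Matrix.fromBlocks_transpose,
      Matrix.fromBlocks_mul_fromRows, Matrix.fromBlocks_multiply, Matrix.transpose_fromCols]
  commm := by
    simp [halfSandwich, sandwich, CSSCode.directSum, Matrix.fromCols_mul_fromBlocks,
      Matrix.mul_fromCols, Matrix.fromBlocks_mul_fromRows, Matrix.fromBlocks_multiply,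
      S'.PX_mul_incl₀]

/-- The map `D → T`. -/
def sandwichInr (S : LogicalSubcomplex C dV) (S' : LogicalSubcomplex D dV) :
    CSSHom D (sandwich S S') where
  deg1 := Matrix.fromRows (Matrix.fromRows 0 1) 0
  deg0 := Matrix.fromRows (Matrix.fromRows 0 1) 0
  degm := Matrix.fromRows 0 1
  comm0 := by
    simp [sandwich, CSSCode.directSum, Matrix.fromBlocks_transpose,
      Matrix.fromBlocks_mul_fromRows, Matrix.fromRows_mul, Matrix.transpose_fromCols]
  commm := by
    simp [sandwich, CSSCode.directSum, Matrix.fromCols_mul_fromRows,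
      Matrix.fromBlocks_mul_fromRows, Matrix.fromRows_mul]

theorem halfSandwich_isPushout (S : LogicalSubcomplex C dV) :
    IsCSSPushout S.hom (middleInl dV) (halfInl S) (halfInr S) := by
  refine ⟨?_, ?_⟩
  · ext1
    · ext a b; exact b.elim
    · simp [CSSHom.comp, LogicalSubcomplex.hom, middleInl, halfInl, halfInr,
        Matrix.fromRows_mul, Matrix.fromBlocks_mul_fromRows]
    · simp [CSSHom.comp, LogicalSubcomplex.hom, middleInl, halfInl, halfInr,
        Matrix.fromRows_mul, Matrix.fromBlocks_mul_fromRows]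
  · intro X' Q' Z' _ _ _ E k' l' h
    obtain ⟨k1, k0, km, hk0, hkm⟩ := k'
    obtain ⟨l1, l0, lm, hl0, hlm⟩ := l'
    obtain ⟨a, b, c, rfl⟩ : ∃ a b c, l0 = Matrix.fromCols (Matrix.fromCols a b) c :=
      ⟨l0.toCols₁.toCols₁, l0.toCols₁.toCols₂, l0.toCols₂, by simp⟩
    obtain ⟨p, q, rfl⟩ : ∃ p q, lm = Matrix.fromCols p q := ⟨lm.toCols₁, lm.toCols₂, by simp⟩
    have h0 := congrArg CSSHom.deg0 h
    have hm := congrArg CSSHom.degm h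
    simp [CSSHom.comp, LogicalSubcomplex.hom, middleInl, Matrix.fromCols_mul_fromRows] at h0 hm
    simp [middleCode, Matrix.transpose_fromCols, Matrix.fromCols_mul_fromRows] at hl0
    simp [middleCode, Matrix.mul_fromCols, Matrix.fromCols_mul_fromBlocks,
      Matrix.fromCols_mul_fromRows, Matrix.fromCols_inj.eq_iff] at hlm
    refine ⟨⟨Matrix.fromCols k1 l1, Matrix.fromCols (Matrix.fromCols k0 b) c,
      Matrix.fromCols km q, ?_, ?_⟩, ⟨?_, ?_⟩, ?_⟩
    · simp [halfSandwich, Matrix.fromBlocks_transpose, Matrix.transpose_fromCols,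
        Matrix.fromCols_mul_fromBlocks, Matrix.mul_fromCols, Matrix.fromCols_mul_fromRows,
        hk0, h0, ← hl0]
    · simp [halfSandwich, Matrix.mul_fromCols, Matrix.fromCols_mul_fromBlocks,
        Matrix.fromCols_mul_fromRows, hkm, hm, hlm]
    · ext1 <;> simp [CSSHom.comp, halfInl, Matrix.fromCols_mul_fromRows]
    · ext1 <;> simp [CSSHom.comp, halfInr, Matrix.fromCols_mul_fromRows,
        Matrix.fromCols_mul_fromBlocks, h0, hm]
    · rintro ⟨t1, t0, tm, ht0, htm⟩ ⟨e1, e2⟩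
      obtain ⟨u, v, rfl⟩ : ∃ u v, t1 = Matrix.fromCols u v := ⟨t1.toCols₁, t1.toCols₂, by simp⟩
      obtain ⟨x, y, z, rfl⟩ : ∃ x y z, t0 = Matrix.fromCols (Matrix.fromCols x y) z :=
        ⟨t0.toCols₁.toCols₁, t0.toCols₁.toCols₂, t0.toCols₂, by simp⟩
      obtain ⟨r, s, rfl⟩ : ∃ r s, tm = Matrix.fromCols r s := ⟨tm.toCols₁, tm.toCols₂, by simp⟩
      simp [CSSHom.comp, halfInl, halfInr, Matrix.fromCols_mul_fromRows, Matrix.fromCols_inj.eq_iff,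
        Matrix.fromCols_mul_fromBlocks] at e1 e2
      simp [e1, e2]

theorem sandwich_isPushout (S : LogicalSubcomplex C dV) (S' : LogicalSubcomplex D dV) :
    IsCSSPushout S'.hom ((halfInr S).comp (middleInr dV)) (sandwichInr S S')
      (sandwichInl S S') := by
  refine ⟨?_, ?_⟩
  · ext1
    · ext a b; exact b.elim
    · simp [CSSHom.comp, LogicalSubcomplex.hom, middleInr, sandwichInl, sandwichInr, halfInr,
        Matrix.fromRows_mul, Matrix.fromBlocks_mul_fromRows]
    · simp [CSSHom.comp, LogicalSubcomplex.hom, middleInr, sandwichInl, sandwichInr, halfInr,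
        Matrix.fromRows_mul, Matrix.fromBlocks_mul_fromRows]
  · intro X' Q' Z' _ _ _ E k' l' h
    obtain ⟨k1, k0, km, hk0, hkm⟩ := k'
    obtain ⟨l1, l0, lm, hl0, hlm⟩ := l'
    obtain ⟨u, v, rfl⟩ : ∃ u v, l1 = Matrix.fromCols u v := ⟨l1.toCols₁, l1.toCols₂, by simp⟩
    obtain ⟨a, b, c, rfl⟩ : ∃ a b c, l0 = Matrix.fromCols (Matrix.fromCols a b) c :=
      ⟨l0.toCols₁.toCols₁, l0.toCols₁.toCols₂, l0.toCols₂, by simp⟩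
    obtain ⟨p, q, rfl⟩ : ∃ p q, lm = Matrix.fromCols p q := ⟨lm.toCols₁, lm.toCols₂, by simp⟩
    have h0 := congrArg CSSHom.deg0 h
    have hm := congrArg CSSHom.degm h
    simp [CSSHom.comp, LogicalSubcomplex.hom, middleInr, halfInr, Matrix.fromCols_mul_fromRows,
      Matrix.fromBlocks_mul_fromRows] at h0 hm
    simp [halfSandwich, Matrix.fromBlocks_transpose, Matrix.transpose_fromCols,
      Matrix.mul_fromCols, Matrix.fromCols_mul_fromRows, Matrix.fromCols_mul_fromBlocks,
      Matrix.fromCols_inj.eq_iff] at hl0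
    simp [halfSandwich, Matrix.mul_fromCols, Matrix.fromCols_mul_fromBlocks,
      Matrix.fromCols_mul_fromRows, Matrix.fromCols_inj.eq_iff] at hlm
    refine ⟨⟨Matrix.fromCols (Matrix.fromCols u k1) v, Matrix.fromCols (Matrix.fromCols a k0) c,
      Matrix.fromCols p km, ?_, ?_⟩, ⟨?_, ?_⟩, ?_⟩
    · simp [sandwich, CSSCode.directSum, Matrix.fromBlocks_transpose, Matrix.transpose_fromCols,
        Matrix.fromCols_mul_fromBlocks, Matrix.mul_fromCols, Matrix.fromCols_mul_fromRows,
        hk0, h0, ← hl0]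
    · simp [sandwich, CSSCode.directSum, Matrix.mul_fromCols, Matrix.fromCols_mul_fromBlocks,
        Matrix.fromCols_mul_fromRows, hkm, hm, hlm]
    · ext1 <;> simp [CSSHom.comp, sandwichInr, Matrix.fromCols_mul_fromRows]
    · ext1 <;> simp [CSSHom.comp, sandwichInl, Matrix.fromCols_mul_fromRows,
        Matrix.fromCols_mul_fromBlocks, h0, hm]
    · rintro ⟨t1, t0, tm, ht0, htm⟩ ⟨e1, e2⟩
      obtain ⟨u', v', w', rfl⟩ : ∃ x y z, t1 = Matrix.fromCols (Matrix.fromCols x y) z :=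
        ⟨t1.toCols₁.toCols₁, t1.toCols₁.toCols₂, t1.toCols₂, by simp⟩
      obtain ⟨x, y, z, rfl⟩ : ∃ x y z, t0 = Matrix.fromCols (Matrix.fromCols x y) z :=
        ⟨t0.toCols₁.toCols₁, t0.toCols₁.toCols₂, t0.toCols₂, by simp⟩
      obtain ⟨r, s, rfl⟩ : ∃ r s, tm = Matrix.fromCols r s := ⟨tm.toCols₁, tm.toCols₂, by simp⟩
      simp [CSSHom.comp, sandwichInl, sandwichInr, Matrix.fromCols_mul_fromRows,
        Matrix.fromCols_inj.eq_iff, Matrix.fromCols_mul_fromBlocks] at e1 e2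
      simp [e1, e2]

end Pushout

/-! ## Qubits, Pauli operators and stabiliser measurement

Operators between qubit registers are matrices indexed by bit strings (the computational basis). -/

section Quantum

/-- The sign `(-1)^s`. -/
def sgn (s : ZMod 2) : ℂ := (-1) ^ s.val

/-- The Pauli operator `X^x Z^z`. -/
def pauli {Q : Type*} [Fintype Q] [DecidableEq Q] (x z : Q → ZMod 2) :
    Matrix (Q → ZMod 2) (Q → ZMod 2) ℂ :=
  Matrix.of fun q q' => if q = q' + x then sgn (z ⬝ᵥ q') else 0

/-- The number of qubits on which `X^x Z^z` acts nontrivially. -/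
def pauliWeight {Q : Type*} [Fintype Q] (x z : Q → ZMod 2) : ℕ :=
  (Finset.univ.filter fun q => x q ≠ 0 ∨ z q ≠ 0).card

/-- The projector onto the `(-1)^s`-eigenspace of `X^x Z^z`, for `X^x Z^z` an involution. -/
def pauliProj {Q : Type*} [Fintype Q] [DecidableEq Q] (x z : Q → ZMod 2) (s : ZMod 2) :
    Matrix (Q → ZMod 2) (Q → ZMod 2) ℂ :=
  (1 / 2 : ℂ) • (1 + sgn s • pauli x z)

/-- A syndrome: one outcome bit for each `X`-check and each `Z`-check. -/
abbrev Syndrome (X Z : Type*) := (X → ZMod 2) × (Z → ZMod 2)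

/-- Measuring every check of `C` once, with outcomes `s`.  The projectors commute, so the order of
the measurements is immaterial. -/
def CSSCode.syndromeProj {X Q Z : Type*} [Fintype X] [Fintype Q] [Fintype Z] [DecidableEq Q]
    (C : CSSCode X Q Z) (s : Syndrome X Z) : Matrix (Q → ZMod 2) (Q → ZMod 2) ℂ :=
  (Finset.univ.toList.map fun a => pauliProj (C.PX a) 0 (s.1 a)).prod *
    (Finset.univ.toList.map fun b => pauliProj 0 (C.PZ b) (s.2 b)).prod

/-- Adjoining fresh qubits `A`, each in the state `|+⟩`. -/
def plusPrep (Q A : Type*) [Fintype Q] [Fintype A] [DecidableEq Q] :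
    Matrix (Q ⊕ A → ZMod 2) (Q → ZMod 2) ℂ :=
  Matrix.of fun q q' =>
    if (fun i => q (Sum.inl i)) = q' then (((Real.sqrt 2)⁻¹ ^ Fintype.card A : ℝ) : ℂ) else 0

/-- The isometry from logical to physical qubits for two codes in parallel. -/
def pairEncoder {QC QD KC KD : Type*} (eC : Matrix (QC → ZMod 2) (KC → ZMod 2) ℂ)
    (eD : Matrix (QD → ZMod 2) (KD → ZMod 2) ℂ) :
    Matrix (QC ⊕ QD → ZMod 2) (KC ⊕ KD → ZMod 2) ℂ :=
  Matrix.of fun q a => eC (fun p => q (Sum.inl p)) (fun k => a (Sum.inl k)) *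
    eD (fun p => q (Sum.inr p)) (fun k => a (Sum.inr k))

/-- The branch with outcome `(-1)^c` of the `Z̄ ⊗ Z̄` measurement of logical qubits `i` and `j`, as a
map of logical qubits.  After the projection onto `Z̄ᵢ Z̄ⱼ = (-1)^c`, the flip `X̄ᵢ` is applied if
`c = 1`, and `|00⟩ ↦ |0⟩`, `|11⟩ ↦ |1⟩` merges `i` and `j` into one logical qubit, labelled `i`;
the other logical qubits are unaffected. -/
def zzBranch {KC KD : Type*} [Fintype KC] [Fintype KD] [DecidableEq KC] [DecidableEq KD]
    (i : KC) (j : KD) (c : ZMod 2) :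
    Matrix (KC ⊕ {l : KD // l ≠ j} → ZMod 2) (KC ⊕ KD → ZMod 2) ℂ :=
  Matrix.of fun t a =>
    if a (Sum.inl i) + a (Sum.inr j) = c ∧
        (∀ l, t (Sum.inl l) = a (Sum.inl l) + if l = i then c else 0) ∧
        (∀ l : {l : KD // l ≠ j}, t (Sum.inr l) = a (Sum.inr l.1))
    then 1 else 0

/-- A code-deformation procedure on data qubits `Q`.  Fresh qubits `A` are prepared in `|+⟩`, all
checks of `code` are measured in each of `rounds` rounds, and then, as functions of the recorded
outcomes, an outcome bit is reported and a Pauli correction `X^x Z^z` is applied. -/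
structure Procedure (X Q A Z : Type*) [Fintype Q] [Fintype A] where
  code : CSSCode X (Q ⊕ A) Z
  rounds : ℕ
  report : (Fin rounds → Syndrome X Z) → ZMod 2
  correction : (Fin rounds → Syndrome X Z) → (Q ⊕ A → ZMod 2) × (Q ⊕ A → ZMod 2)

/-- A pattern of faults in `n` rounds of check measurements on qubits `Q`: Pauli errors
on the qubits before the first round (including errors of the input and of the preparation of fresh
qubits) and after each round, and flips of recorded outcomes. -/
structure Faults (n : ℕ) (X Q Z : Type*) where
  xErr : Fin (n + 1) → Q → ZMod 2
  zErr : Fin (n + 1) → Q → ZMod 2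
  flips : Fin n → Syndrome X Z

/-- The absence of faults. -/
def Faults.none (n : ℕ) (X Q Z : Type*) : Faults n X Q Z := ⟨0, 0, 0⟩

/-- The number of elementary faults: single-qubit Pauli errors and flipped outcome bits. -/
def Faults.weight {n : ℕ} {X Q Z : Type*} [Fintype X] [Fintype Q] [Fintype Z]
    (F : Faults n X Q Z) : ℕ :=
  (∑ t, pauliWeight (F.xErr t) (F.zErr t)) +
    ∑ t, (hammingNorm (F.flips t).1 + hammingNorm (F.flips t).2)

namespace Procedure

variable {X Q A Z : Type*} [Fintype X] [Fintype Q] [Fintype A] [Fintype Z]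
  [DecidableEq Q] [DecidableEq A]

/-- The Kraus operator of the procedure for the recorded outcomes `o`, under the faults `F`. -/
def kraus (P : Procedure X Q A Z) (F : Faults P.rounds X (Q ⊕ A) Z)
    (o : Fin P.rounds → Syndrome X Z) : Matrix (Q ⊕ A → ZMod 2) (Q → ZMod 2) ℂ :=
  pauli (P.correction o).1 (P.correction o).2 *
    (List.ofFn fun t : Fin P.rounds =>
      pauli (F.xErr t.succ) (F.zErr t.succ) *
        P.code.syndromeProj (o t + F.flips t)).reverse.prod *
    pauli (F.xErr 0) (F.zErr 0) * plusPrep Q A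

variable {L L' : Type*} [Fintype L']

open scoped Classical in
/-- Without faults, on inputs encoded by `enc`, the procedure is the measurement with branches
`ideal c` on the logical space, with output encoded by `enc'`: each record `o` occurs with a
probability amplitude `κ o` times the branch for the reported outcome, and the probabilities
`|κ o|²` of the records reporting `c` add up to one. -/
def Implements (P : Procedure X Q A Z) (enc : Matrix (Q → ZMod 2) L ℂ)
    (enc' : Matrix (Q ⊕ A → ZMod 2) L' ℂ) (ideal : ZMod 2 → Matrix L' L ℂ) : Prop :=
  ∃ κ : (Fin P.rounds → Syndrome X Z) → ℂ,
    (∀ o, P.kraus (Faults.none _ _ _ _) o * enc = κ o • (enc' * ideal (P.report o))) ∧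
    ∀ c, ∑ o with P.report o = c, ‖κ o‖ ^ 2 = 1

/-- The record `o` is unsuspicious: it can occur without faults on some encoded input. -/
def Unsuspicious (P : Procedure X Q A Z) (enc : Matrix (Q → ZMod 2) L ℂ)
    (o : Fin P.rounds → Syndrome X Z) : Prop :=
  P.kraus (Faults.none _ _ _ _) o * enc ≠ 0

/-- The procedure detects fewer than `d` faults: if they occur and the record is unsuspicious, then
the branch of the reported outcome has been performed on the logical space, up to a scalar and a
residual Pauli error on at most as many qubits as there were faults. -/
def Detects (P : Procedure X Q A Z) (enc : Matrix (Q → ZMod 2) L ℂ)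
    (enc' : Matrix (Q ⊕ A → ZMod 2) L' ℂ) (ideal : ZMod 2 → Matrix L' L ℂ) (d : ℕ) : Prop :=
  ∀ F : Faults P.rounds X (Q ⊕ A) Z, F.weight < d → ∀ o, P.Unsuspicious enc o →
    ∃ (x z : Q ⊕ A → ZMod 2) (κ : ℂ), pauliWeight x z ≤ F.weight ∧
      P.kraus F o * enc = κ • (pauli x z * enc' * ideal (P.report o))

/-- The procedure corrects fewer than `d / 2` faults: for every record `o`, the reported outcome is
that of the branch which has been performed on the logical space, and the output state is recovered
exactly (up to a scalar) by a Pauli correction that depends only on `o` and on the syndrome `s` of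
one further, faultless, measurement of the checks. -/
def Corrects (P : Procedure X Q A Z) (enc : Matrix (Q → ZMod 2) L ℂ)
    (enc' : Matrix (Q ⊕ A → ZMod 2) L' ℂ) (ideal : ZMod 2 → Matrix L' L ℂ) (d : ℕ) : Prop :=
  ∃ recover : (Fin P.rounds → Syndrome X Z) → Syndrome X Z →
      (Q ⊕ A → ZMod 2) × (Q ⊕ A → ZMod 2),
    ∀ F : Faults P.rounds X (Q ⊕ A) Z, 2 * F.weight < d → ∀ o s, ∃ κ : ℂ,
      pauli (recover o s).1 (recover o s).2 * P.code.syndromeProj s * P.kraus F o * enc =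
        κ • (enc' * ideal (P.report o))

/-- The procedure is fault-tolerant with distance `d`. -/
def FaultTolerant (P : Procedure X Q A Z) (enc : Matrix (Q → ZMod 2) L ℂ)
    (enc' : Matrix (Q ⊕ A → ZMod 2) L' ℂ) (ideal : ZMod 2 → Matrix L' L ℂ) (d : ℕ) : Prop :=
  P.Detects enc enc' ideal d ∧ P.Corrects enc enc' ideal d

end Procedure

end Quantum

end

/-!
The sandwiched code `T` is the mapping cone of `V → C ⊕ D`, so that its homology and its logical
`X`-classes are read off from those of `C` and `D`.  Since `∂ : V₀ → V₋₁` is surjective, each cycle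
of `T` is homologous to one on `C ⊕ D`, and relations between such cycles come from the cycles of
`V`.  By separation these are either trivial in both codes or equal to `[u]ᵢ` and `[v]ⱼ`
(`Sandwich.homologyInl_add_homologyInr_eq_zero`), so that `[u]ᵢ = [v]ⱼ` is the only new relation;
this gives the basis `Sandwich.homologyBasis`.  A nontrivial logical `X`-operator of `T` restricts
to a nontrivial one of `C ⊕ D` (`Sandwich.distance_le_hammingNorm`), which bounds the distance.

On an encoded input with fresh qubits in `|+⟩`, the old checks and all `X`-checks of `T` have
outcome `0`.  The outcomes of the new `Z`-checks select bit strings: those with `aᵢ + aⱼ = c` and a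
syndrome that is undone by `X̄ᵢᶜ X^τ`, for a unique `τ` on the fresh qubits.  Hence the first round
has `2 ^ r` equally likely records for each `c`, and each of them performs the logical branch of
`c` up to the Pauli operator `Sandwich.shift` (`Sandwich.syndromeProj_mul_input`).  This uses that
the strings of a logical class of `T` are the pairs of strings in classes of `C` and `D` with equal
bits `i` and `j`, extended uniquely to the fresh qubits (`Sandwich.elim_mem_xClass_iff`).

For fault tolerance, Pauli errors are moved to the end of the rounds, where each of them shifts the
later outcomes by its syndrome (`CSSCode.exists_rounds_eq`).  A record thus has nonzero amplitude
only if all rounds, once corrected for flips and earlier errors, agree with one faultless record.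
If two explanations of the same record involve fewer than `d` faults in total, then one of the `d`
rounds has no flip in either, so that the `X`-errors before this round account for the difference
of the faultless records.  On `C ⊕ D` they have weight below the distance and hence are logically
trivial; therefore the outcomes `c` agree (`RoundData.outcome_eq`).  Detection compares the actual
faults with the absence of faults.  Correction compares them with any explanation by fewer than
`d / 2` faults; the syndrome of one further round then leaves an `X`-part that is trivial for
the same reason and a `Z`-part that is a product of checks by the assumption on `Z₀(T) \ B₀(T)`.
-/

noncomputable section

/-! ### Cycles, boundaries and logical classes -/

namespace CSSCode

variable {X Q Z : Type*} [Fintype Q] (C : CSSCode X Q Z)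

variable {C} in
theorem mem_cycles {z : Q → ZMod 2} : z ∈ C.cycles ↔ C.PX *ᵥ z = 0 := by
  simp [cycles]

variable {C} in
theorem mem_dual_cycles {q : Q → ZMod 2} : q ∈ C.dual.cycles ↔ C.PZ *ᵥ q = 0 := by
  simp [cycles, dual]

section DirectSum

variable {X' Q' Z' : Type*} [Fintype Q'] (D : CSSCode X' Q' Z')

variable {C D} in
theorem elim_mem_directSum_cycles_iff {q : Q → ZMod 2} {q' : Q' → ZMod 2} :
    Sum.elim q q' ∈ (C.directSum D).cycles ↔ q ∈ C.cycles ∧ q' ∈ D.cycles := by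
  simp only [mem_cycles, directSum, Matrix.fromBlocks_mulVec]
  rw [← Sum.elim_zero_zero, Sum.elim_eq_iff]
  simp

theorem directSum_dual : (C.directSum D).dual = C.dual.directSum D.dual := rfl

end DirectSum

variable [Fintype Z]

variable {C} in
theorem mem_boundaries {z : Q → ZMod 2} : z ∈ C.boundaries ↔ ∃ w, C.PZᵀ *ᵥ w = z := by
  simp only [boundaries, LinearMap.mem_range, Matrix.mulVecLin_apply]

theorem boundaries_le_cycles : C.boundaries ≤ C.cycles := by
  intro z hz
  obtain ⟨w, rfl⟩ := mem_boundaries.1 hz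
  rw [mem_cycles, Matrix.mulVec_mulVec, C.comm, Matrix.zero_mulVec]

/-- The homology class of a cycle. -/
def homologyClass : C.cycles →ₗ[ZMod 2] C.H0 :=
  Submodule.mkQ _

theorem homologyClass_surjective : Function.Surjective C.homologyClass :=
  Submodule.mkQ_surjective _

variable {C} in
theorem homologyClass_eq_zero {z : C.cycles} :
    C.homologyClass z = 0 ↔ (z : Q → ZMod 2) ∈ C.boundaries := by
  simp [homologyClass]

variable {C} in
theorem represents_iff {z : Q → ZMod 2} {h : C.H0} :
    C.Represents z h ↔ ∃ hz : z ∈ C.cycles, C.homologyClass ⟨z, hz⟩ = h := Iff.rfl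

theorem exists_represents (h : C.H0) : ∃ z, C.Represents z h := by
  obtain ⟨z, hz⟩ := C.homologyClass_surjective h
  exact ⟨z, z.2, hz⟩

variable {C} in
theorem Represents.add_mem_boundaries {z z' : Q → ZMod 2} {h : C.H0} (hz : C.Represents z h)
    (hz' : C.Represents z' h) : z + z' ∈ C.boundaries := by
  obtain ⟨hz, e'⟩ := represents_iff.1 hz
  obtain ⟨hz', e⟩ := represents_iff.1 hz'
  have : C.homologyClass (⟨z', hz'⟩ - ⟨z, hz⟩) = 0 := by rw [map_sub, e, e', sub_self]
  have h2 := homologyClass_eq_zero.1 this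
  rwa [AddSubgroupClass.coe_sub, ZModModule.sub_eq_add, add_comm] at h2

/-- Boundaries are orthogonal to the cycles of the dual code. -/
theorem dotProduct_eq_zero_of_mem_boundaries {z q : Q → ZMod 2} (hz : z ∈ C.boundaries)
    (hq : q ∈ C.dual.cycles) : z ⬝ᵥ q = 0 := by
  obtain ⟨w, rfl⟩ := mem_boundaries.1 hz
  rw [Matrix.mulVec_transpose, ← Matrix.dotProduct_mulVec, mem_dual_cycles.1 hq,
    dotProduct_zero]

variable {K : Type*} (b : Module.Basis K (ZMod 2) C.H0)

variable {C b} in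
theorem add_mem_xClass {q q' : Q → ZMod 2} {a a' : K → ZMod 2} (hq : q ∈ C.xClass b a)
    (hq' : q' ∈ C.xClass b a') : q + q' ∈ C.xClass b (a + a') :=
  ⟨add_mem hq.1 hq'.1, fun l z hz => by
    rw [dotProduct_add, hq.2 l z hz, hq'.2 l z hz, Pi.add_apply]⟩

variable {C b} in
theorem smul_mem_xClass {q : Q → ZMod 2} {a : K → ZMod 2} (hq : q ∈ C.xClass b a)
    (c : ZMod 2) : c • q ∈ C.xClass b (c • a) :=
  ⟨Submodule.smul_mem _ _ hq.1, fun l z hz => by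
    rw [dotProduct_smul, hq.2 l z hz, Pi.smul_apply]⟩

variable {C b} in
theorem add_mem_xClass_iff {q x : Q → ZMod 2} {a a' : K → ZMod 2} (hx : x ∈ C.xClass b a') :
    q + x ∈ C.xClass b (a + a') ↔ q ∈ C.xClass b a := by
  refine ⟨fun h => ?_, fun h => add_mem_xClass h hx⟩
  have := add_mem_xClass h hx
  rwa [add_assoc, ZModModule.add_self, add_zero, add_assoc, ZModModule.add_self,
    add_zero] at this

theorem ncard_xClass_add {x : Q → ZMod 2} {a' : K → ZMod 2} (hx : x ∈ C.xClass b a')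
    (a : K → ZMod 2) : (C.xClass b (a + a')).ncard = (C.xClass b a).ncard := by
  rw [← Set.ncard_image_of_injective (C.xClass b a) (add_left_injective x)]
  congr 1
  ext q
  constructor
  · intro h
    refine ⟨q + x, ?_, ?_⟩
    · rwa [← add_mem_xClass_iff (b := b) hx, add_assoc, ZModModule.add_self, add_zero]
    · simp [add_assoc, ZModModule.add_self]
  · rintro ⟨q, hq, rfl⟩
    exact add_mem_xClass hq hx

theorem row_mem_boundaries (b : Z) : C.PZ b ∈ C.boundaries := by
  classical
  refine mem_boundaries.2 ⟨Pi.single b 1, ?_⟩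
  ext q
  simp

section DirectSum

variable {X' Q' Z' : Type*} [Fintype Q'] [Fintype Z'] (D : CSSCode X' Q' Z')

variable {C D} in
theorem elim_mem_directSum_boundaries_iff {q : Q → ZMod 2} {q' : Q' → ZMod 2} :
    Sum.elim q q' ∈ (C.directSum D).boundaries ↔ q ∈ C.boundaries ∧ q' ∈ D.boundaries := by
  simp only [mem_boundaries, directSum, Matrix.fromBlocks_transpose, Matrix.fromBlocks_mulVec,
    Sum.elim_eq_iff]
  constructor
  · rintro ⟨w, h, h'⟩
    exact ⟨⟨w ∘ Sum.inl, by simpa using h⟩, ⟨w ∘ Sum.inr, by simpa using h'⟩⟩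
  · rintro ⟨⟨w, h⟩, ⟨w', h'⟩⟩
    exact ⟨Sum.elim w w', by simpa using h, by simpa using h'⟩

theorem directSum_isLogicalZ_inl {u : Q → ZMod 2} (hu : C.IsLogicalZ u) :
    (C.directSum D).IsLogicalZ (Sum.elim u 0) :=
  ⟨elim_mem_directSum_cycles_iff.2 ⟨hu.1, zero_mem _⟩,
    fun h => hu.2 (elim_mem_directSum_boundaries_iff.1 h).1⟩

end DirectSum

variable [Fintype X]

/-- Dual boundaries, the products of `X`-checks, represent the trivial logical operator. -/
theorem mem_xClass_zero_of_mem_dual_boundaries {q : Q → ZMod 2} (hq : q ∈ C.dual.boundaries) :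
    q ∈ C.xClass b 0 :=
  ⟨C.dual.boundaries_le_cycles hq, fun l z hz => by
    rw [dotProduct_comm]
    exact C.dual.dotProduct_eq_zero_of_mem_boundaries hq hz.1⟩

theorem distance_le_of_isLogicalX {x : Q → ZMod 2} (h : C.dual.IsLogicalZ x) :
    C.distance ≤ hammingNorm x :=
  Nat.sInf_le ⟨x, Or.inr h, rfl⟩

theorem le_distance {d : ℕ} (h : ∀ v, C.IsLogicalZ v ∨ C.dual.IsLogicalZ v → d ≤ hammingNorm v)
    (hne : ∃ v, C.IsLogicalZ v) : d ≤ C.distance := by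
  obtain ⟨v, hv⟩ := hne
  refine le_csInf ⟨_, v, Or.inl hv, rfl⟩ ?_
  rintro _ ⟨v, hv, rfl⟩
  exact h v hv

theorem distance_pos {v : Q → ZMod 2} (h : C.IsLogicalZ v) : 0 < C.distance := by
  refine Nat.lt_of_lt_of_le zero_lt_one (C.le_distance ?_ ⟨v, h⟩)
  intro w hw
  rw [Nat.one_le_iff_ne_zero, Ne, hammingNorm_eq_zero]
  rintro rfl
  rcases hw with hw | hw <;> exact hw.2 (zero_mem _)

/-- An `X`-operator of the direct sum commuting with the `Z`-checks and of weight below the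
distance is logically trivial on both summands. -/
theorem mem_xClass_zero_of_lt_distance {X' Q' Z' K' : Type*} [Fintype X'] [Fintype Q']
    [Fintype Z'] (D : CSSCode X' Q' Z') (b' : Module.Basis K' (ZMod 2) D.H0)
    {x : Q → ZMod 2} {x' : Q' → ZMod 2} (hx : x ∈ C.dual.cycles) (hx' : x' ∈ D.dual.cycles)
    (hd : hammingNorm (Sum.elim x x') < (C.directSum D).distance) :
    x ∈ C.xClass b 0 ∧ x' ∈ D.xClass b' 0 := by
  have hb : Sum.elim x x' ∈ (C.directSum D).dual.boundaries := by
    have hc : Sum.elim x x' ∈ (C.directSum D).dual.cycles := by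
      rw [directSum_dual, elim_mem_directSum_cycles_iff]
      exact ⟨hx, hx'⟩
    by_contra h
    exact absurd ((C.directSum D).distance_le_of_isLogicalX ⟨hc, h⟩) (not_le.2 hd)
  rw [directSum_dual, elim_mem_directSum_boundaries_iff] at hb
  exact ⟨C.mem_xClass_zero_of_mem_dual_boundaries b hb.1,
    D.mem_xClass_zero_of_mem_dual_boundaries b' hb.2⟩

end CSSCode

theorem hammingNorm_comp_le_of_injective {ι κ : Type*} [Fintype ι] [Fintype κ] {β : Type*}
    [Zero β] [DecidableEq β] (x : ι → β) {f : κ → ι} (hf : Function.Injective f) :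
    hammingNorm (x ∘ f) ≤ hammingNorm x :=
  Finset.card_le_card_of_injOn f (fun k hk => by simpa using hk) hf.injOn

/-- A vector orthogonal to the kernel of `A` lies in the row space of `A`. -/
theorem Matrix.exists_transpose_mulVec_eq {R M F : Type*} [Fintype R] [Fintype M] [Field F]
    (A : Matrix R M F) (w : M → F) (h : ∀ s, A *ᵥ s = 0 → s ⬝ᵥ w = 0) :
    ∃ t, Aᵀ *ᵥ t = w := by
  classical
  have hle : ⨅ r, LinearMap.ker (dotProductBilin F F (A r)) ≤
      LinearMap.ker (dotProductBilin F F w) := by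
    intro s hs
    simp only [Submodule.mem_iInf, LinearMap.mem_ker, dotProductBilin_apply_apply] at hs ⊢
    rw [dotProduct_comm]
    exact h s (funext hs)
  obtain ⟨c, hc⟩ := (Submodule.mem_span_range_iff_exists_fun F).1
    (mem_span_of_iInf_ker_le_ker hle)
  refine ⟨c, funext fun k => ?_⟩
  have := LinearMap.congr_fun hc (Pi.single k 1)
  simpa [Matrix.mulVec, dotProduct, Pi.single_apply, mul_comm] using this

theorem Matrix.transpose_mulVec_injective_of_range_eq_top {R M F : Type*} [Fintype R] [Fintype M]
    [Field F] (A : Matrix R M F) (h : LinearMap.range A.mulVecLin = ⊤) :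
    Function.Injective Aᵀ.mulVec := by
  classical
  intro t t' e
  refine dotProduct_eq _ _ fun v => ?_
  obtain ⟨s, rfl⟩ := LinearMap.range_eq_top.1 h v
  have e' : t ᵥ* A = t' ᵥ* A := by rw [← Matrix.mulVec_transpose, ← Matrix.mulVec_transpose, e]
  rw [Matrix.mulVecLin_apply, Matrix.dotProduct_mulVec, e', Matrix.dotProduct_mulVec]

/-! ### Homology and logical classes of the sandwiched code -/

namespace LogicalSubcomplex

variable {X Q Z R M : Type*} [Fintype X] [Fintype Q] [Fintype Z] [Fintype R] [Fintype M]
  {C : CSSCode X Q Z} {dV : Matrix R M (ZMod 2)} (S : LogicalSubcomplex C dV)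

theorem exists_op_ne_zero : ∃ p, S.op p ≠ 0 := by
  by_contra! h
  exact S.isLogicalZ.2 (by rw [show S.op = 0 from funext h]; exact zero_mem _)

variable [DecidableEq Q]

theorem incl₀_mulVec_emb (s : M → ZMod 2) (k : M) : (S.incl₀ *ᵥ s) (S.emb k) = s k := by
  classical
  simp [Matrix.mulVec, dotProduct, incl₀]

theorem incl₀_mulVec_of_op_eq_zero (s : M → ZMod 2) {q : Q} (hq : S.op q = 0) :
    (S.incl₀ *ᵥ s) q = 0 := by
  refine Finset.sum_eq_zero fun k _ => ?_
  have : S.emb k ≠ q := by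
    rintro rfl
    have : S.emb k ∈ {q | S.op q ≠ 0} := S.range_emb ▸ Set.mem_range_self k
    exact this hq
  simp [incl₀, this]

theorem incl₀_mulVec_one : S.incl₀ *ᵥ 1 = S.op := by
  ext q
  by_cases hq : S.op q = 0
  · rw [S.incl₀_mulVec_of_op_eq_zero 1 hq, hq]
  · obtain ⟨k, rfl⟩ : q ∈ Set.range S.emb := S.range_emb ▸ hq
    rw [S.incl₀_mulVec_emb, Pi.one_apply]
    generalize S.op (S.emb k) = a at hq
    revert a
    decide

theorem incl₀_mulVec_mem_cycles {s : M → ZMod 2} :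
    S.incl₀ *ᵥ s ∈ C.cycles ↔ dV *ᵥ s = 0 := by
  rw [CSSCode.mem_cycles, Matrix.mulVec_mulVec, S.PX_mul_incl₀, ← Matrix.mulVec_mulVec]
  refine ⟨fun h => S.incl_injective ?_, fun h => by rw [h, Matrix.mulVec_zero]⟩
  rw [h, Matrix.mulVec_zero]


theorem differential_mulVec_one (S : LogicalSubcomplex C dV) : dV *ᵥ 1 = 0 := by
  rw [← S.incl₀_mulVec_mem_cycles, S.incl₀_mulVec_one]
  exact S.isLogicalZ.1

end LogicalSubcomplex

namespace Sandwich

variable {XC QC ZC XD QD ZD R M : Type*}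
  [Fintype XC] [Fintype QC] [Fintype ZC] [Fintype XD] [Fintype QD] [Fintype ZD]
  [Fintype R] [Fintype M] [DecidableEq QC] [DecidableEq QD]
  {C : CSSCode XC QC ZC} {D : CSSCode XD QD ZD} {dV : Matrix R M (ZMod 2)}
  (S : LogicalSubcomplex C dV) (S' : LogicalSubcomplex D dV)

theorem PX_mulVec (q : QC → ZMod 2) (q' : QD → ZMod 2) (t : R → ZMod 2) :
    (sandwich S S').PX *ᵥ Sum.elim (Sum.elim q q') t =
      Sum.elim (C.PX *ᵥ q + S.incl *ᵥ t) (D.PX *ᵥ q' + S'.incl *ᵥ t) := by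
  simp only [sandwich, CSSCode.directSum, Matrix.fromCols_mulVec_sumElim,
    Matrix.fromBlocks_mulVec, Matrix.fromRows_mulVec]
  ext (x | x) <;> simp

theorem PZ_transpose_mulVec (c : ZC → ZMod 2) (c' : ZD → ZMod 2) (s : M → ZMod 2) :
    (sandwich S S').PZᵀ *ᵥ Sum.elim (Sum.elim c c') s =
      Sum.elim (Sum.elim (C.PZᵀ *ᵥ c + S.incl₀ *ᵥ s) (D.PZᵀ *ᵥ c' + S'.incl₀ *ᵥ s))
        (dV *ᵥ s) := by
  simp only [sandwich, CSSCode.directSum, Matrix.fromBlocks_transpose,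
    Matrix.fromBlocks_mulVec, Matrix.fromRows_mulVec, Matrix.transpose_fromCols,
    Matrix.transpose_transpose]
  ext ((x | x) | x) <;> simp

theorem PZ_mulVec (q : QC → ZMod 2) (q' : QD → ZMod 2) (t : R → ZMod 2) :
    (sandwich S S').PZ *ᵥ Sum.elim (Sum.elim q q') t =
      Sum.elim (Sum.elim (C.PZ *ᵥ q) (D.PZ *ᵥ q'))
        (S.incl₀ᵀ *ᵥ q + S'.incl₀ᵀ *ᵥ q' + dVᵀ *ᵥ t) := by
  simp only [sandwich, CSSCode.directSum, Matrix.fromBlocks_mulVec]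
  ext ((x | x) | x) <;> simp

theorem PX_transpose_mulVec (y : XC → ZMod 2) (y' : XD → ZMod 2) :
    (sandwich S S').PXᵀ *ᵥ Sum.elim y y' =
      Sum.elim (Sum.elim (C.PXᵀ *ᵥ y) (D.PXᵀ *ᵥ y')) (S.inclᵀ *ᵥ y + S'.inclᵀ *ᵥ y') := by
  simp only [sandwich, CSSCode.directSum, Matrix.fromBlocks_transpose, Matrix.transpose_fromRows,
    Matrix.fromBlocks_mulVec, Matrix.fromRows_mulVec, Matrix.transpose_fromCols,
    Matrix.fromCols_mulVec_sumElim]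
  ext ((x | x) | x) <;> simp

theorem elim_mem_cycles_iff {q : QC → ZMod 2} {q' : QD → ZMod 2} :
    Sum.elim (Sum.elim q q') 0 ∈ (sandwich S S').cycles ↔ q ∈ C.cycles ∧ q' ∈ D.cycles := by
  rw [CSSCode.mem_cycles, CSSCode.mem_cycles, CSSCode.mem_cycles, PX_mulVec, Matrix.mulVec_zero,
    Matrix.mulVec_zero, add_zero, add_zero, ← Sum.elim_zero_zero, Sum.elim_eq_iff]

theorem elim_mem_boundaries_iff {q : QC → ZMod 2} {q' : QD → ZMod 2} :
    Sum.elim (Sum.elim q q') 0 ∈ (sandwich S S').boundaries ↔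
      ∃ s, dV *ᵥ s = 0 ∧ q + S.incl₀ *ᵥ s ∈ C.boundaries ∧ q' + S'.incl₀ *ᵥ s ∈ D.boundaries := by
  simp only [CSSCode.mem_boundaries]
  constructor
  · rintro ⟨w, hw⟩
    obtain ⟨c, c', s, rfl⟩ : ∃ c c' s, w = Sum.elim (Sum.elim c c') s :=
      ⟨w ∘ Sum.inl ∘ Sum.inl, w ∘ Sum.inl ∘ Sum.inr, w ∘ Sum.inr, by ext ((_ | _) | _) <;> rfl⟩
    rw [PZ_transpose_mulVec, Sum.elim_eq_iff, Sum.elim_eq_iff] at hw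
    obtain ⟨⟨rfl, rfl⟩, hs⟩ := hw
    exact ⟨s, hs, ⟨c, by rw [add_assoc, ZModModule.add_self, add_zero]⟩,
      ⟨c', by rw [add_assoc, ZModModule.add_self, add_zero]⟩⟩
  · rintro ⟨s, hs, ⟨c, hc⟩, ⟨c', hc'⟩⟩
    refine ⟨Sum.elim (Sum.elim c c') s, ?_⟩
    rw [PZ_transpose_mulVec, hc, hc', hs, add_assoc, add_assoc, ZModModule.add_self,
      ZModModule.add_self, add_zero, add_zero]

/-- Each cycle of the sandwiched code is homologous to one supported on `C ⊕ D`, since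
`V₀ → V₋₁` is surjective. -/
theorem exists_add_mem_boundaries {z : (QC ⊕ QD) ⊕ R → ZMod 2} (hz : z ∈ (sandwich S S').cycles) :
    ∃ q ∈ C.cycles, ∃ q' ∈ D.cycles,
      Sum.elim (Sum.elim q q') 0 + z ∈ (sandwich S S').boundaries := by
  obtain ⟨q, q', t, rfl⟩ : ∃ q q' t, z = Sum.elim (Sum.elim q q') t :=
    ⟨z ∘ Sum.inl ∘ Sum.inl, z ∘ Sum.inl ∘ Sum.inr, z ∘ Sum.inr, by ext ((_ | _) | _) <;> rfl⟩
  obtain ⟨s, hs⟩ := LinearMap.range_eq_top.1 S.surjective t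
  have hb : (sandwich S S').PZᵀ *ᵥ Sum.elim (Sum.elim 0 0) s ∈ (sandwich S S').boundaries :=
    CSSCode.mem_boundaries.2 ⟨_, rfl⟩
  have hsum : Sum.elim (Sum.elim (q + S.incl₀ *ᵥ s) (q' + S'.incl₀ *ᵥ s)) 0 +
      Sum.elim (Sum.elim q q') t = (sandwich S S').PZᵀ *ᵥ Sum.elim (Sum.elim 0 0) s := by
    rw [PZ_transpose_mulVec, ← Matrix.mulVecLin_apply dV, hs]
    ext ((x | x) | x)
    · simp [add_right_comm _ _ (q x), CharTwo.add_self_eq_zero]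
    · simp [add_right_comm _ _ (q' x), CharTwo.add_self_eq_zero]
    · simp
  have hc : Sum.elim (Sum.elim (q + S.incl₀ *ᵥ s) (q' + S'.incl₀ *ᵥ s)) 0 ∈
      (sandwich S S').cycles :=
    (Submodule.add_mem_iff_left _ hz).1 (by
      rw [hsum]; exact (sandwich S S').boundaries_le_cycles hb)
  rw [elim_mem_cycles_iff] at hc
  exact ⟨_, hc.1, _, hc.2, by rw [hsum]; exact hb⟩

/-- A nontrivial logical `X`-operator of `T` restricts to one of `C ⊕ D`: the checks of `C ⊕ D`
extend to `T`, and an `X`-operator on the qubits of `V₋₁` alone is detected because `∂` is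
surjective. -/
theorem distance_le_hammingNorm {x : (QC ⊕ QD) ⊕ R → ZMod 2}
    (hx : (sandwich S S').dual.IsLogicalZ x) :
    (C.directSum D).distance ≤ hammingNorm x := by
  obtain ⟨q, q', t, rfl⟩ : ∃ q q' t, x = Sum.elim (Sum.elim q q') t :=
    ⟨x ∘ Sum.inl ∘ Sum.inl, x ∘ Sum.inl ∘ Sum.inr, x ∘ Sum.inr, by ext ((_ | _) | _) <;> rfl⟩
  obtain ⟨hx, hxb⟩ := hx
  rw [CSSCode.mem_dual_cycles, PZ_mulVec, ← Sum.elim_zero_zero, Sum.elim_eq_iff,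
    ← Sum.elim_zero_zero, Sum.elim_eq_iff] at hx
  obtain ⟨⟨hq, hq'⟩, ht⟩ := hx
  refine (CSSCode.distance_le_of_isLogicalX _ (x := Sum.elim q q') ⟨?_, fun h => hxb ?_⟩).trans
    (hammingNorm_comp_le_of_injective (Sum.elim (Sum.elim q q') t) Sum.inl_injective)
  · rw [CSSCode.directSum_dual, CSSCode.elim_mem_directSum_cycles_iff]
    exact ⟨hq, hq'⟩
  · rw [CSSCode.directSum_dual, CSSCode.elim_mem_directSum_boundaries_iff,
      CSSCode.mem_boundaries, CSSCode.mem_boundaries] at h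
    obtain ⟨⟨y, rfl⟩, ⟨y', rfl⟩⟩ := h
    refine CSSCode.mem_boundaries.2 ⟨Sum.elim y y', ?_⟩
    refine (PX_transpose_mulVec S S' y y').trans (congrArg _ ?_)
    have h0 := PZ_mulVec S S' (C.PXᵀ *ᵥ y) (D.PXᵀ *ᵥ y') (S.inclᵀ *ᵥ y + S'.inclᵀ *ᵥ y')
    rw [← PX_transpose_mulVec, Matrix.mulVec_mulVec,
      show (sandwich S S').PZ * (sandwich S S').PXᵀ = 0 from (sandwich S S').dual.comm,
      Matrix.zero_mulVec, ← Sum.elim_zero_zero, Sum.elim_eq_iff] at h0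
    refine Matrix.transpose_mulVec_injective_of_range_eq_top dV S.surjective ?_
    exact add_left_cancel (h0.2.symm.trans ht.symm)

/-! ### A basis of the homology of the sandwiched code -/

/-- The map `H₀(C) → H₀(T)` induced by the inclusion of the qubits of `C`. -/
def homologyInl : C.H0 →ₗ[ZMod 2] (sandwich S S').H0 :=
  Submodule.mapQ _ _
    { toFun := fun z => ⟨Sum.elim (Sum.elim z 0) 0,
        (elim_mem_cycles_iff S S').2 ⟨z.2, zero_mem _⟩⟩
      map_add' := fun z w => by
        ext ((_ | _) | _) <;> simp
      map_smul' := fun a z => by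
        ext ((_ | _) | _) <;> simp }
    (fun z hz => (elim_mem_boundaries_iff S S').2 ⟨0, by simp, by simpa using hz, by simp⟩)

/-- The map `H₀(D) → H₀(T)` induced by the inclusion of the qubits of `D`. -/
def homologyInr : D.H0 →ₗ[ZMod 2] (sandwich S S').H0 :=
  Submodule.mapQ _ _
    { toFun := fun z => ⟨Sum.elim (Sum.elim 0 z) 0,
        (elim_mem_cycles_iff S S').2 ⟨zero_mem _, z.2⟩⟩
      map_add' := fun z w => by
        ext ((_ | _) | _) <;> simp
      map_smul' := fun a z => by
        ext ((_ | _) | _) <;> simp }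
    (fun z hz => (elim_mem_boundaries_iff S S').2 ⟨0, by simp, by simp, by simpa using hz⟩)

variable {S S'}

theorem represents_homologyInl {z : QC → ZMod 2} {h : C.H0} (hz : C.Represents z h) :
    (sandwich S S').Represents (Sum.elim (Sum.elim z 0) 0) (homologyInl S S' h) := by
  obtain ⟨hz, rfl⟩ := hz
  exact ⟨(elim_mem_cycles_iff S S').2 ⟨hz, zero_mem _⟩, rfl⟩

theorem represents_homologyInr {z : QD → ZMod 2} {h : D.H0} (hz : D.Represents z h) :
    (sandwich S S').Represents (Sum.elim (Sum.elim 0 z) 0) (homologyInr S S' h) := by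
  obtain ⟨hz, rfl⟩ := hz
  exact ⟨(elim_mem_cycles_iff S S').2 ⟨zero_mem _, hz⟩, rfl⟩

theorem homologyInl_add_homologyInr (z : C.cycles) (z' : D.cycles) :
    homologyInl S S' (C.homologyClass z) + homologyInr S S' (D.homologyClass z') =
      (sandwich S S').homologyClass ⟨Sum.elim (Sum.elim z z') 0,
        (elim_mem_cycles_iff S S').2 ⟨z.2, z'.2⟩⟩ := by
  refine Eq.trans (map_add (sandwich S S').homologyClass _ _).symm (congrArg _ ?_)
  ext ((_ | _) | _) <;> simp

variable {KC KD : Type*} {bC : Module.Basis KC (ZMod 2) C.H0} {bD : Module.Basis KD (ZMod 2) D.H0}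
  {i : KC} {j : KD}

/-- The only relation between the images of `H₀(C)` and `H₀(D)` in `H₀(T)` is
`[u]ᵢ = [v]ⱼ`: relations come from cycles of `V`, which by separation are either trivial in both
codes or map to `[u]ᵢ` and `[v]ⱼ`. -/
theorem homologyInl_add_homologyInr_eq_zero (hsep : Separated bC bD i j S S') {h : C.H0}
    {h' : D.H0} (e : homologyInl S S' h + homologyInr S S' h' = 0) :
    (h = 0 ∧ h' = 0) ∨ (h = bC i ∧ h' = bD j) := by
  obtain ⟨z, rfl⟩ := C.homologyClass_surjective h
  obtain ⟨z', rfl⟩ := D.homologyClass_surjective h'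
  rw [homologyInl_add_homologyInr, CSSCode.homologyClass_eq_zero, elim_mem_boundaries_iff] at e
  obtain ⟨s, hs, hz, hz'⟩ := e
  have hc := S.incl₀_mulVec_mem_cycles.2 hs
  have hc' := S'.incl₀_mulVec_mem_cycles.2 hs
  have e1 : C.homologyClass z = C.homologyClass ⟨_, hc⟩ := by
    rw [← sub_eq_zero, ← map_sub, CSSCode.homologyClass_eq_zero, ZModModule.sub_eq_add]
    exact hz
  have e2 : D.homologyClass z' = D.homologyClass ⟨_, hc'⟩ := by
    rw [← sub_eq_zero, ← map_sub, CSSCode.homologyClass_eq_zero, ZModModule.sub_eq_add]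
    exact hz'
  rw [e1, e2]
  by_cases hl : C.IsLogicalZ (S.incl₀ *ᵥ s)
  · right
    obtain ⟨_, h1⟩ := hsep.only_left _ hl
      (fun q hq h0 => hq (S.incl₀_mulVec_of_op_eq_zero s h0))
    obtain ⟨_, h2⟩ := hsep.only_right _ ((hsep.iff s).1 hl)
      (fun q hq h0 => hq (S'.incl₀_mulVec_of_op_eq_zero s h0))
    exact ⟨h1, h2⟩
  · left
    have hl' := fun h => hl ((hsep.iff s).2 h)
    rw [CSSCode.homologyClass_eq_zero, CSSCode.homologyClass_eq_zero]
    exact ⟨not_not.1 fun h => hl ⟨hc, h⟩, not_not.1 fun h => hl' ⟨hc', h⟩⟩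

/-- The boundary of the sum of the basis of `V₀` identifies `[u]ᵢ` with `[v]ⱼ` in `H₀(T)`. -/
theorem homologyInr_eq_homologyInl (hsep : Separated bC bD i j S S') :
    homologyInr S S' (bD j) = homologyInl S S' (bC i) := by
  obtain ⟨hu, eu⟩ := CSSCode.represents_iff.1 hsep.class_left
  obtain ⟨hv, ev⟩ := CSSCode.represents_iff.1 hsep.class_right
  rw [eq_comm, ← sub_eq_zero, ZModModule.sub_eq_add, ← eu, ← ev, homologyInl_add_homologyInr,
    CSSCode.homologyClass_eq_zero, elim_mem_boundaries_iff]
  refine ⟨1, S.differential_mulVec_one, ?_, ?_⟩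
  · simp [S.incl₀_mulVec_one, ZModModule.add_self]
  · simp [S'.incl₀_mulVec_one, ZModModule.add_self]

theorem exists_eq_homologyInl_add_homologyInr (x : (sandwich S S').H0) :
    ∃ h h', x = homologyInl S S' h + homologyInr S S' h' := by
  obtain ⟨z, rfl⟩ := (sandwich S S').homologyClass_surjective x
  obtain ⟨q, hq, q', hq', hb⟩ := exists_add_mem_boundaries S S' z.2
  refine ⟨C.homologyClass ⟨q, hq⟩, D.homologyClass ⟨q', hq'⟩, ?_⟩
  rw [homologyInl_add_homologyInr, eq_comm, ← sub_eq_zero, ← map_sub,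
    CSSCode.homologyClass_eq_zero, ZModModule.sub_eq_add]
  exact hb

variable [Fintype KC] [Fintype KD] [DecidableEq KD]

/-- The images of `[u]ₖ` for all `k`, and of `[v]ₗ` for `l ≠ j`, form a basis of `H₀(T)`. -/
def homologyBasis (hsep : Separated bC bD i j S S') :
    Module.Basis (KC ⊕ {l : KD // l ≠ j}) (ZMod 2) (sandwich S S').H0 :=
  Module.Basis.mk
    (v := Sum.elim (fun k => homologyInl S S' (bC k)) fun l => homologyInr S S' (bD l))
    (by
      rw [Fintype.linearIndependent_iff]
      intro g hg
      rw [Fintype.sum_sum_type] at hg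
      simp only [Sum.elim_inl, Sum.elim_inr, ← map_smul, ← map_sum] at hg
      have hsum : ∑ l : {l : KD // l ≠ j}, g (Sum.inr l) • bD l =
          ∑ l, (if h : l ≠ j then g (Sum.inr ⟨l, h⟩) else 0) • bD l := by
        rw [← Fintype.sum_subtype_add_sum_subtype (· ≠ j)]
        have h0 : ∑ l : {l // ¬ l ≠ j}, (if h : (l : KD) ≠ j then g (Sum.inr ⟨l, h⟩) else 0) •
            bD l = 0 := Finset.sum_eq_zero fun l _ => by rw [dif_neg l.2, zero_smul]
        rw [h0, add_zero]
        exact Finset.sum_congr rfl fun l _ => by rw [dif_pos l.2]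
      rcases homologyInl_add_homologyInr_eq_zero hsep hg with ⟨h1, h2⟩ | ⟨h1, h2⟩
      · rw [hsum] at h2
        have h1 := Fintype.linearIndependent_iff.1 bC.linearIndependent _ h1
        have h2 := Fintype.linearIndependent_iff.1 bD.linearIndependent _ h2
        rintro (k | l)
        · exact h1 k
        · simpa [l.2] using h2 l
      · -- the left-hand side of `h2` has no component along `[v]ⱼ`
        exfalso
        rw [hsum] at h2
        have := DFunLike.congr_fun (congrArg bD.repr h2) j
        rw [Module.Basis.repr_self] at this
        rw [bD.repr_sum_self] at this
        simp at this)
    (by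
      rintro x -
      obtain ⟨h, h', rfl⟩ := exists_eq_homologyInl_add_homologyInr x
      have hl : ∀ k, homologyInl S S' (bC k) ∈ Submodule.span (ZMod 2) (Set.range
          (Sum.elim (fun k => homologyInl S S' (bC k))
            fun l : {l : KD // l ≠ j} => homologyInr S S' (bD l))) :=
        fun k => Submodule.subset_span ⟨Sum.inl k, rfl⟩
      refine add_mem ?_ ?_
      · rw [← bC.sum_repr h, map_sum]
        exact Submodule.sum_mem _ fun k _ => by
          rw [map_smul]; exact Submodule.smul_mem _ _ (hl k)
      · rw [← bD.sum_repr h', map_sum]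
        refine Submodule.sum_mem _ fun k _ => ?_
        rw [map_smul]
        refine Submodule.smul_mem _ _ ?_
        by_cases hk : k = j
        · rw [hk, homologyInr_eq_homologyInl hsep]
          exact hl i
        · exact Submodule.subset_span ⟨Sum.inr ⟨k, hk⟩, rfl⟩)

theorem homologyBasis_inl (hsep : Separated bC bD i j S S') (k : KC) :
    homologyBasis hsep (Sum.inl k) = homologyInl S S' (bC k) := by
  simp [homologyBasis]

theorem homologyBasis_inr (hsep : Separated bC bD i j S S') (l : {l : KD // l ≠ j}) :
    homologyBasis hsep (Sum.inr l) = homologyInr S S' (bD l) := by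
  simp [homologyBasis]

end Sandwich

/-! ### Logical `X`-classes of the sandwiched code -/

theorem Matrix.dotProduct_transpose_mulVec' {m n F : Type*} [Fintype m] [Fintype n]
    [CommRing F] (A : Matrix m n F) (s : n → F) (q : m → F) : s ⬝ᵥ Aᵀ *ᵥ q = A *ᵥ s ⬝ᵥ q := by
  rw [A.dotProduct_transpose_mulVec, dotProduct_comm]

namespace Sandwich

variable {XC QC ZC XD QD ZD R M : Type*}
  [Fintype XC] [Fintype QC] [Fintype ZC] [Fintype XD] [Fintype QD] [Fintype ZD]
  [Fintype R] [Fintype M] [DecidableEq QC] [DecidableEq QD]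
  {C : CSSCode XC QC ZC} {D : CSSCode XD QD ZD} {dV : Matrix R M (ZMod 2)}
  {S : LogicalSubcomplex C dV} {S' : LogicalSubcomplex D dV}
  {KC KD : Type*} {bC : Module.Basis KC (ZMod 2) C.H0} {bD : Module.Basis KD (ZMod 2) D.H0}
  {i : KC} {j : KD}

/-- The label of a logical qubit state of `T` from labels for `C` and `D`, dropping the bit `j`
of `D`, which is identified with the bit `i` of `C`. -/
def mergedLabel (j : KD) (a : KC → ZMod 2) (b : KD → ZMod 2) :
    KC ⊕ {l : KD // l ≠ j} → ZMod 2 :=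
  Sum.elim a fun l => b l

theorem elim_mem_dual_cycles_iff {q : QC → ZMod 2} {q' : QD → ZMod 2} {t : R → ZMod 2} :
    Sum.elim (Sum.elim q q') t ∈ (sandwich S S').dual.cycles ↔
      q ∈ C.dual.cycles ∧ q' ∈ D.dual.cycles ∧
        dVᵀ *ᵥ t = S.incl₀ᵀ *ᵥ q + S'.incl₀ᵀ *ᵥ q' := by
  rw [CSSCode.mem_dual_cycles, PZ_mulVec, ← Sum.elim_zero_zero, Sum.elim_eq_iff,
    ← Sum.elim_zero_zero, Sum.elim_eq_iff, CSSCode.mem_dual_cycles, CSSCode.mem_dual_cycles,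
    and_assoc, ← ZModModule.sub_eq_add (_ + _) (dVᵀ *ᵥ t), sub_eq_zero, eq_comm (b := dVᵀ *ᵥ t)]

/-- A product of the new `Z`-checks, taken over a cycle of `V`, restricts to the identity or to
`Z̄ᵢ` on `C` and at the same time to the identity or to `Z̄ⱼ` on `D`. -/
theorem exists_dotProduct_eq (hsep : Separated bC bD i j S S') {s : M → ZMod 2}
    (hs : dV *ᵥ s = 0) : ∃ ε : ZMod 2, ∀ {q q' a b}, q ∈ C.xClass bC a → q' ∈ D.xClass bD b →
      s ⬝ᵥ S.incl₀ᵀ *ᵥ q = ε * a i ∧ s ⬝ᵥ S'.incl₀ᵀ *ᵥ q' = ε * b j := by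
  have hc := S.incl₀_mulVec_mem_cycles.2 hs
  have hc' := S'.incl₀_mulVec_mem_cycles.2 hs
  simp only [Matrix.dotProduct_transpose_mulVec']
  by_cases hl : C.IsLogicalZ (S.incl₀ *ᵥ s)
  · refine ⟨1, fun hq hq' => ?_⟩
    rw [one_mul, one_mul]
    exact ⟨hq.2 _ _ (hsep.only_left _ hl (fun q hq h0 => hq (S.incl₀_mulVec_of_op_eq_zero s h0))),
      hq'.2 _ _ (hsep.only_right _ ((hsep.iff s).1 hl)
        (fun q hq h0 => hq (S'.incl₀_mulVec_of_op_eq_zero s h0)))⟩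
  · refine ⟨0, fun hq hq' => ?_⟩
    rw [zero_mul, zero_mul]
    exact ⟨C.dotProduct_eq_zero_of_mem_boundaries (not_not.1 fun h => hl ⟨hc, h⟩) hq.1,
      D.dotProduct_eq_zero_of_mem_boundaries
        (not_not.1 fun h => hl ((hsep.iff s).2 ⟨hc', h⟩)) hq'.1⟩

/-- Bit strings of `C` and `D` in logical classes with equal bits `i` and `j` extend to `V₋₁` so that
the new `Z`-checks are satisfied. -/
theorem exists_transpose_mulVec_eq (hsep : Separated bC bD i j S S') {q : QC → ZMod 2}
    {q' : QD → ZMod 2} {a : KC → ZMod 2} {b : KD → ZMod 2} (hab : a i = b j)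
    (h : q ∈ C.xClass bC a) (h' : q' ∈ D.xClass bD b) :
    ∃ t, dVᵀ *ᵥ t = S.incl₀ᵀ *ᵥ q + S'.incl₀ᵀ *ᵥ q' :=
  dV.exists_transpose_mulVec_eq _ fun s hs => by
    obtain ⟨ε, hε⟩ := exists_dotProduct_eq hsep hs
    rw [dotProduct_add, (hε h h').1, (hε h h').2, hab, CharTwo.add_self_eq_zero]

variable [Fintype KC] [Fintype KD] [DecidableEq KD]

/-- The bit strings of `T` in a logical class are those whose restrictions lie in logical classes
of `C` and `D` with equal bits `i` and `j`, and which satisfy the new `Z`-checks. -/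
theorem elim_mem_xClass_iff (hsep : Separated bC bD i j S S') {q : QC → ZMod 2}
    {q' : QD → ZMod 2} {t : R → ZMod 2} {a : KC → ZMod 2} {b : KD → ZMod 2} :
    (a i = b j ∧ Sum.elim (Sum.elim q q') t ∈
        (sandwich S S').xClass (homologyBasis hsep) (mergedLabel j a b)) ↔
      q ∈ C.xClass bC a ∧ q' ∈ D.xClass bD b ∧
        dVᵀ *ᵥ t = S.incl₀ᵀ *ᵥ q + S'.incl₀ᵀ *ᵥ q' := by
  constructor
  · rintro ⟨hab, hc, hx⟩
    obtain ⟨hq, hq', ht⟩ := elim_mem_dual_cycles_iff.1 hc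
    refine ⟨⟨hq, fun k z hz => ?_⟩, ⟨hq', fun l z hz => ?_⟩, ht⟩
    · have := hx (Sum.inl k) _ (homologyBasis_inl hsep k ▸ represents_homologyInl hz)
      simpa [mergedLabel, sumElim_dotProduct_sumElim] using this
    · by_cases hl : l = j
      · subst hl
        have := hx (Sum.inl i) _ (homologyBasis_inl hsep i ▸
          homologyInr_eq_homologyInl hsep ▸ represents_homologyInr hz)
        simpa [mergedLabel, sumElim_dotProduct_sumElim, hab] using this
      · have := hx (Sum.inr ⟨l, hl⟩) _ (homologyBasis_inr hsep ⟨l, hl⟩ ▸ represents_homologyInr hz)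
        simpa [mergedLabel, sumElim_dotProduct_sumElim] using this
  · rintro ⟨hq, hq', ht⟩
    have hc : Sum.elim (Sum.elim q q') t ∈ (sandwich S S').dual.cycles :=
      elim_mem_dual_cycles_iff.2 ⟨hq.1, hq'.1, ht⟩
    -- pairing the new checks with the sum of the basis of `V₀` compares the bits `i` and `j`
    have hab : a i = b j := by
      have h := congrArg (fun w => 1 ⬝ᵥ w) ht
      simp only [dotProduct_add, Matrix.dotProduct_transpose_mulVec', S.differential_mulVec_one,
        S.incl₀_mulVec_one, S'.incl₀_mulVec_one, zero_dotProduct,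
        hq.2 _ _ hsep.class_left, hq'.2 _ _ hsep.class_right] at h
      exact CharTwo.add_eq_zero.1 h.symm
    refine ⟨hab, hc, ?_⟩
    have key : ∀ {h : (sandwich S S').H0} {z w}, (sandwich S S').Represents z h →
        (sandwich S S').Represents w h →
        w ⬝ᵥ Sum.elim (Sum.elim q q') t = z ⬝ᵥ Sum.elim (Sum.elim q q') t := fun hz hw => by
      have := (sandwich S S').dotProduct_eq_zero_of_mem_boundaries (hw.add_mem_boundaries hz) hc
      rw [add_dotProduct] at this
      exact CharTwo.add_eq_zero.1 this
    rintro (k | l) w hw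
    · obtain ⟨z, hz⟩ := C.exists_represents (bC k)
      rw [homologyBasis_inl] at hw
      rw [key (represents_homologyInl hz) hw]
      simpa [mergedLabel, sumElim_dotProduct_sumElim] using hq.2 k z hz
    · obtain ⟨z, hz⟩ := D.exists_represents (bD l)
      rw [homologyBasis_inr] at hw
      rw [key (represents_homologyInr hz) hw]
      simpa [mergedLabel, sumElim_dotProduct_sumElim] using hq'.2 l z hz

/-- The number of bit strings in a logical class of `T` is the product of the numbers for `C` and
`D`: the bits on `V₋₁` are determined by the others, as `∂ᵀ` is injective. -/
theorem ncard_xClass (hsep : Separated bC bD i j S S') {a : KC → ZMod 2} {b : KD → ZMod 2}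
    (hab : a i = b j) :
    ((sandwich S S').xClass (homologyBasis hsep) (mergedLabel j a b)).ncard =
      (C.xClass bC a).ncard * (D.xClass bD b).ncard := by
  let f : ((QC ⊕ QD) ⊕ R → ZMod 2) → (QC → ZMod 2) × (QD → ZMod 2) :=
    fun x => (x ∘ Sum.inl ∘ Sum.inl, x ∘ Sum.inl ∘ Sum.inr)
  have hx : ∀ x : (QC ⊕ QD) ⊕ R → ZMod 2, ∃ q q' t, x = Sum.elim (Sum.elim q q') t :=
    fun x => ⟨x ∘ Sum.inl ∘ Sum.inl, x ∘ Sum.inl ∘ Sum.inr, x ∘ Sum.inr,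
      by ext ((_ | _) | _) <;> rfl⟩
  rw [← Set.ncard_prod, ← Set.InjOn.ncard_image (f := f)]
  · congr 1
    ext ⟨q, q'⟩
    simp only [Set.mem_image, Set.mem_prod]
    constructor
    · rintro ⟨x, h, e⟩
      obtain ⟨p, p', t, rfl⟩ := hx x
      obtain ⟨rfl, rfl⟩ := Prod.ext_iff.1 e
      have := (elim_mem_xClass_iff hsep).1 ⟨hab, h⟩
      exact ⟨this.1, this.2.1⟩
    · rintro ⟨h, h'⟩
      obtain ⟨t, ht⟩ := exists_transpose_mulVec_eq hsep hab h h'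
      exact ⟨_, ((elim_mem_xClass_iff hsep).2 ⟨h, h', ht⟩).2, rfl⟩
  · intro x h x' h' e
    obtain ⟨p, p', t, rfl⟩ := hx x
    obtain ⟨q, q', t', rfl⟩ := hx x'
    obtain ⟨h1, h2⟩ := Prod.ext_iff.1 e
    obtain rfl : p = q := h1
    obtain rfl : p' = q' := h2
    rw [Matrix.transpose_mulVec_injective_of_range_eq_top dV S.surjective
      (((elim_mem_xClass_iff hsep).1 ⟨hab, h⟩).2.2.trans
        ((elim_mem_xClass_iff hsep).1 ⟨hab, h'⟩).2.2.symm)]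

end Sandwich

/-! ### Pauli operators and stabiliser measurements -/

theorem sgn_add (s t : ZMod 2) : sgn (s + t) = sgn s * sgn t := by
  have : ∀ s t : ZMod 2, (s + t).val = s.val + t.val ∨ s.val + t.val = (s + t).val + 2 := by
    decide
  simp only [sgn, ← pow_add]
  rcases this s t with h | h
  · rw [h]
  · rw [h, pow_add]; simp

@[simp]
theorem sgn_zero : sgn 0 = 1 := by simp [sgn]

@[simp]
theorem sgn_one : sgn 1 = -1 := by simp [sgn, ZMod.val_one]

theorem sgn_mul_self (s : ZMod 2) : sgn s * sgn s = 1 := by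
  rw [← sgn_add, CharTwo.add_self_eq_zero, sgn_zero]

@[simp]
theorem norm_sgn (s : ZMod 2) : ‖sgn s‖ = 1 := by simp [sgn]

theorem half_mul_one_add_sgn (s t : ZMod 2) :
    (1 / 2 : ℂ) * (1 + sgn (s + t)) = if s = t then 1 else 0 := by
  split_ifs with h
  · rw [h, CharTwo.add_self_eq_zero]; norm_num
  · have h1 : s + t = 1 := by
      have : ∀ s t : ZMod 2, s ≠ t → s + t = 1 := by decide
      exact this s t h
    rw [h1]; norm_num

section Pauli

variable {Q L : Type*} [Fintype Q] [DecidableEq Q]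

theorem pauli_mul_apply (x z : Q → ZMod 2) (M : Matrix (Q → ZMod 2) L ℂ) (q : Q → ZMod 2)
    (l : L) : (pauli x z * M) q l = sgn (z ⬝ᵥ (q + x)) * M (q + x) l := by
  have h : ∀ q', q = q' + x ↔ q' = q + x := fun q' => by
    constructor <;> rintro rfl <;> rw [add_assoc, ZModModule.add_self, add_zero]
  simp [Matrix.mul_apply, pauli, h]

theorem pauli_mul_pauli (x z x' z' : Q → ZMod 2) :
    pauli x z * pauli x' z' = sgn (z ⬝ᵥ x') • pauli (x + x') (z + z') := by
  ext q q'
  rw [pauli_mul_apply]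
  have h : q + x = q' + x' ↔ q = q' + (x + x') := by
    rw [add_comm x, ← add_assoc, ← sub_eq_iff_eq_add (b := x), ZModModule.sub_eq_add]
  simp only [pauli, Matrix.of_apply, Matrix.smul_apply, smul_eq_mul, mul_ite, mul_zero, h]
  split_ifs with h1
  · rw [h.2 h1, ← sgn_add, ← sgn_add, dotProduct_add, add_dotProduct]
    congr 1
    ring
  · rfl

@[simp]
theorem pauli_zero : pauli (0 : Q → ZMod 2) 0 = 1 := by
  ext q q'
  simp [pauli, Matrix.one_apply]

theorem pauli_mul_comm (x z x' z' : Q → ZMod 2) :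
    pauli x' z' * pauli x z = sgn (z' ⬝ᵥ x + x' ⬝ᵥ z) • (pauli x z * pauli x' z') := by
  rw [pauli_mul_pauli, pauli_mul_pauli, smul_smul, add_comm x, add_comm z, sgn_add,
    dotProduct_comm x' z, mul_assoc, sgn_mul_self, mul_one]

theorem pauliProj_mul_pauli (x z x' z' : Q → ZMod 2) (s : ZMod 2) :
    pauliProj x' z' s * pauli x z = pauli x z * pauliProj x' z' (s + (z' ⬝ᵥ x + x' ⬝ᵥ z)) := by
  rw [pauliProj, pauliProj, Matrix.smul_mul, Matrix.mul_smul, add_mul, mul_add, one_mul, mul_one,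
    Matrix.smul_mul, Matrix.mul_smul, pauli_mul_comm, smul_smul, ← sgn_add]

theorem pauliProj_mul_of_eigen {x z : Q → ZMod 2} {M : Matrix (Q → ZMod 2) L ℂ} {t : ZMod 2}
    (h : pauli x z * M = sgn t • M) (s : ZMod 2) :
    pauliProj x z s * M = if s = t then M else 0 := by
  rw [pauliProj, Matrix.smul_mul, Matrix.add_mul, Matrix.one_mul, Matrix.smul_mul, h, smul_smul, ← sgn_add]
  nth_rw 1 [← one_smul ℂ M]
  rw [← add_smul, smul_smul, half_mul_one_add_sgn, ite_smul, one_smul, zero_smul]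

theorem pauliProj_zero_left_mul_apply (z : Q → ZMod 2) (s : ZMod 2) (M : Matrix (Q → ZMod 2) L ℂ)
    (q : Q → ZMod 2) (l : L) :
    (pauliProj 0 z s * M) q l = if z ⬝ᵥ q = s then M q l else 0 := by
  rw [pauliProj, Matrix.smul_mul, Matrix.add_mul, Matrix.one_mul, Matrix.smul_mul, Matrix.smul_apply,
    Matrix.add_apply, Matrix.smul_apply, pauli_mul_apply, add_zero]
  simp only [smul_eq_mul, eq_comm (b := s)]
  rw [← mul_assoc (sgn s), ← sgn_add, ← one_add_mul, ← mul_assoc, half_mul_one_add_sgn, ite_mul,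
    one_mul, zero_mul]

theorem list_prod_mul_pauli {ι : Type*} (l : List ι)
    {f g : ι → Matrix (Q → ZMod 2) (Q → ZMod 2) ℂ} {x z : Q → ZMod 2}
    (hfg : ∀ a, f a * pauli x z = pauli x z * g a) :
    (l.map f).prod * pauli x z = pauli x z * (l.map g).prod := by
  induction l with
  | nil => simp
  | cons a l ih =>
    rw [List.map_cons, List.map_cons, List.prod_cons, List.prod_cons, mul_assoc, ih, ← mul_assoc,
      hfg, mul_assoc]

theorem list_prod_mul_eq_ite {ι : Type*} (l : List ι)
    {f : ι → Matrix (Q → ZMod 2) (Q → ZMod 2) ℂ} {M : Matrix (Q → ZMod 2) L ℂ}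
    {p : ι → Prop} [DecidablePred p] (hf : ∀ a, f a * M = if p a then M else 0) :
    (l.map f).prod * M = if ∀ a ∈ l, p a then M else 0 := by
  induction l with
  | nil => simp [Matrix.one_mul]
  | cons a l ih =>
    rw [List.map_cons, List.prod_cons, Matrix.mul_assoc, ih]
    by_cases hl : ∀ a ∈ l, p a
    · rw [if_pos hl, hf]
      exact if_congr ⟨fun h => List.forall_mem_cons.2 ⟨h, hl⟩, fun h => (List.forall_mem_cons.1 h).1⟩
        rfl rfl
    · rw [if_neg hl, Matrix.mul_zero, if_neg fun h => hl (List.forall_mem_cons.1 h).2]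

/-- Measuring commuting `Z`-checks selects the bit strings with the given outcomes. -/
theorem list_prod_mul_apply {ι : Type*} (l : List ι) (z : ι → Q → ZMod 2) (s : ι → ZMod 2)
    (M : Matrix (Q → ZMod 2) L ℂ) (q : Q → ZMod 2) (k : L) :
    ((l.map fun b => pauliProj 0 (z b) (s b)).prod * M) q k =
      if ∀ b ∈ l, z b ⬝ᵥ q = s b then M q k else 0 := by
  induction l with
  | nil => simp [Matrix.one_mul]
  | cons a l ih =>
    rw [List.map_cons, List.prod_cons, Matrix.mul_assoc, pauliProj_zero_left_mul_apply, ih]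
    simp only [List.mem_cons, forall_eq_or_imp, ite_and]

end Pauli

section Weight

variable {Q : Type*} [Fintype Q]

theorem hammingNorm_left_le_pauliWeight (x z : Q → ZMod 2) : hammingNorm x ≤ pauliWeight x z :=
  Finset.card_le_card fun q => by simp +contextual

theorem hammingNorm_right_le_pauliWeight (x z : Q → ZMod 2) : hammingNorm z ≤ pauliWeight x z :=
  Finset.card_le_card fun q => by simp +contextual

theorem hammingNorm_add_le {x y : Q → ZMod 2} :
    hammingNorm (x + y) ≤ hammingNorm x + hammingNorm y := by
  have := hammingDist_triangle x 0 y
  rwa [hammingDist_zero_right, hammingDist_zero_left, hammingDist_eq_hammingNorm,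
    ZModModule.neg_eq_self] at this

theorem pauliWeight_zero_left (z : Q → ZMod 2) : pauliWeight 0 z = hammingNorm z := by
  simp [pauliWeight, hammingNorm]

theorem pauliWeight_add_le (x z x' z' : Q → ZMod 2) :
    pauliWeight (x + x') (z + z') ≤ pauliWeight x z + pauliWeight x' z' := by
  classical
  refine (Finset.card_le_card (fun q => ?_)).trans (Finset.card_union_le _ _)
  simp only [Finset.mem_filter, Finset.mem_univ, true_and, Finset.mem_union, Pi.add_apply]
  contrapose!
  rintro ⟨⟨h1, h2⟩, h3, h4⟩
  simp [h1, h2, h3, h4]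

theorem pauliWeight_sum_le {ι : Type*} (s : Finset ι) (x z : ι → Q → ZMod 2) :
    pauliWeight (∑ t ∈ s, x t) (∑ t ∈ s, z t) ≤ ∑ t ∈ s, pauliWeight (x t) (z t) := by
  classical
  induction s using Finset.induction_on with
  | empty => simp [pauliWeight]
  | insert t s ht ih =>
    rw [Finset.sum_insert ht, Finset.sum_insert ht, Finset.sum_insert ht]
    exact (pauliWeight_add_le _ _ _ _).trans (by gcongr)

end Weight

namespace CSSCode

variable {X Q Z L : Type*} [Fintype Q] (T : CSSCode X Q Z)

/-- The change of syndrome caused by the Pauli error `X^x Z^z`. -/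
def syndromeOf (x z : Q → ZMod 2) : Syndrome X Z := (T.PX *ᵥ z, T.PZ *ᵥ x)

variable [DecidableEq Q]

/-- The columns of `M` are joint eigenvectors of the checks, with syndrome `s`. -/
def HasSyndrome (s : Syndrome X Z) (M : Matrix (Q → ZMod 2) L ℂ) : Prop :=
  (∀ a, pauli (T.PX a) 0 * M = sgn (s.1 a) • M) ∧ ∀ b, pauli 0 (T.PZ b) * M = sgn (s.2 b) • M

/-- A Pauli error changes the syndrome of a state by its own. -/
theorem HasSyndrome.pauli_mul {T : CSSCode X Q Z} {s : Syndrome X Z} {M : Matrix (Q → ZMod 2) L ℂ}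
    (h : T.HasSyndrome s M) (x z : Q → ZMod 2) :
    T.HasSyndrome (s + T.syndromeOf x z) (pauli x z * M) := by
  refine ⟨fun a => ?_, fun b => ?_⟩
  · rw [← Matrix.mul_assoc, pauli_mul_comm, Matrix.smul_mul, Matrix.mul_assoc, h.1 a,
      Matrix.mul_smul, smul_smul, ← sgn_add, zero_dotProduct, zero_add, add_comm]
    rfl
  · rw [← Matrix.mul_assoc, pauli_mul_comm, Matrix.smul_mul, Matrix.mul_assoc, h.2 b,
      Matrix.mul_smul, smul_smul, ← sgn_add, zero_dotProduct, add_zero, add_comm]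
    rfl

variable [Fintype X] [Fintype Z]

/-- A Pauli error before a measurement is a Pauli error after it, with shifted outcomes. -/
theorem syndromeProj_mul_pauli (s : Syndrome X Z) (x z : Q → ZMod 2) :
    T.syndromeProj s * pauli x z = pauli x z * T.syndromeProj (s + T.syndromeOf x z) := by
  rw [syndromeProj, syndromeProj, mul_assoc,
    list_prod_mul_pauli _ fun b => pauliProj_mul_pauli x z 0 (T.PZ b) (s.2 b), ← mul_assoc,
    list_prod_mul_pauli _ fun a => pauliProj_mul_pauli x z (T.PX a) 0 (s.1 a), mul_assoc]
  congr 4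
  · ext1 a
    simp [syndromeOf, Matrix.mulVec]
  · ext1 a
    simp [syndromeOf, Matrix.mulVec]

theorem HasSyndrome.syndromeProj_mul {T : CSSCode X Q Z} {s : Syndrome X Z}
    {M : Matrix (Q → ZMod 2) L ℂ} (h : T.HasSyndrome s M) (s' : Syndrome X Z) [Decidable (s' = s)] :
    T.syndromeProj s' * M = if s' = s then M else 0 := by
  rw [syndromeProj, Matrix.mul_assoc,
    list_prod_mul_eq_ite _ fun b => pauliProj_mul_of_eigen (h.2 b) (s'.2 b)]
  by_cases hb : ∀ b ∈ Finset.univ.toList, s'.2 b = s.2 b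
  · rw [if_pos hb, list_prod_mul_eq_ite _ fun a => pauliProj_mul_of_eigen (h.1 a) (s'.1 a)]
    refine if_congr ⟨fun ha => Prod.ext (funext fun a => ha a (by simp))
      (funext fun b => hb b (by simp)), fun h => by simp [h]⟩ rfl rfl
  · rw [if_neg hb, Matrix.mul_zero, if_neg fun h => hb (by simp [h])]

/-- Measuring the checks on a family of states invariant under the `X`-checks: the `X`-outcomes
vanish, and the `Z`-outcomes select bit strings. -/
theorem syndromeProj_mul_apply {M : Matrix (Q → ZMod 2) L ℂ}
    (h : ∀ a, pauli (T.PX a) 0 * M = M) (s : Syndrome X Z) (q : Q → ZMod 2) (l : L)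
    [Decidable (s.1 = 0 ∧ T.PZ *ᵥ q = s.2)] :
    (T.syndromeProj s * M) q l = if s.1 = 0 ∧ T.PZ *ᵥ q = s.2 then M q l else 0 := by
  set N := (Finset.univ.toList.map fun b => pauliProj 0 (T.PZ b) (s.2 b)).prod * M with hN
  have hNa : ∀ q l, N q l = if T.PZ *ᵥ q = s.2 then M q l else 0 := fun q l => by
    rw [hN]
    refine (list_prod_mul_apply _ (fun b => T.PZ b) s.2 M q l).trans (if_congr ?_ rfl rfl)
    simp only [Finset.mem_toList, Finset.mem_univ, true_imp_iff, funext_iff]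
    rfl
  have hrow : ∀ a, T.PZ *ᵥ T.PX a = 0 := fun a =>
    CSSCode.mem_cycles.1 (T.dual.boundaries_le_cycles (T.dual.row_mem_boundaries a))
  -- the `Z`-outcomes are unchanged by an `X`-check, so that the selected part is still invariant
  have hinv : ∀ a, pauli (T.PX a) 0 * N = sgn 0 • N := fun a => by
    ext q l
    rw [sgn_zero, one_smul, pauli_mul_apply, zero_dotProduct, sgn_zero, one_mul, hNa, hNa,
      Matrix.mulVec_add, hrow, add_zero]
    refine if_congr Iff.rfl ?_ rfl
    conv_rhs => rw [← h a]
    rw [pauli_mul_apply, zero_dotProduct, sgn_zero, one_mul]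
  rw [syndromeProj, Matrix.mul_assoc, ← hN,
    list_prod_mul_eq_ite _ fun a => pauliProj_mul_of_eigen (hinv a) (s.1 a)]
  by_cases hs : s.1 = 0
  · rw [if_pos (by simp [hs]), hNa]
    simp [hs]
  · rw [if_neg (by simpa [funext_iff] using hs), if_neg fun h => hs h.1, Matrix.zero_apply]

end CSSCode

/-! ### Faulty measurement rounds -/

namespace CSSCode

variable {X Q Z L L' : Type*} [Fintype Q] {T : CSSCode X Q Z}

theorem syndromeOf_zero : T.syndromeOf 0 0 = 0 := by
  simp [syndromeOf]

variable [DecidableEq Q]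

theorem HasSyndrome.mul_right {s : Syndrome X Z} [Fintype L] {M : Matrix (Q → ZMod 2) L ℂ}
    (h : T.HasSyndrome s M) (N : Matrix L L' ℂ) : T.HasSyndrome s (M * N) :=
  ⟨fun a => by rw [← Matrix.mul_assoc, h.1, Matrix.smul_mul],
    fun b => by rw [← Matrix.mul_assoc, h.2, Matrix.smul_mul]⟩

theorem HasSyndrome.smul {s : Syndrome X Z} {M : Matrix (Q → ZMod 2) L ℂ}
    (h : T.HasSyndrome s M) (c : ℂ) : T.HasSyndrome s (c • M) :=
  ⟨fun a => by rw [Matrix.mul_smul, h.1, smul_comm],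
    fun b => by rw [Matrix.mul_smul, h.2, smul_comm]⟩

variable [Fintype X] [Fintype Z]

variable (T) in
/-- All Pauli errors may be moved to the end of the measurement rounds; an error shifts the
outcomes of all later rounds by its syndrome. -/
theorem exists_rounds_eq (n : ℕ) (x z : Fin (n + 1) → Q → ZMod 2) (s : Fin n → Syndrome X Z) :
    ∃ e : ZMod 2,
      (List.ofFn fun t : Fin n => pauli (x t.succ) (z t.succ) * T.syndromeProj (s t)).reverse.prod *
          pauli (x 0) (z 0) =
        sgn e • (pauli (∑ t, x t) (∑ t, z t) *
          (List.ofFn fun t : Fin n => T.syndromeProj (s t + T.syndromeOf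
            (∑ k with k ≤ t.castSucc, x k) (∑ k with k ≤ t.castSucc, z k))).reverse.prod) := by
  induction n with
  | zero => exact ⟨0, by simp⟩
  | succ n ih =>
    obtain ⟨e, he⟩ := ih (fun k => x k.castSucc) (fun k => z k.castSucc) fun t => s t.castSucc
    simp only [← Fin.succ_castSucc, Fin.castSucc_zero] at he
    have hsum : ∀ (y : Fin (n + 2) → Q → ZMod 2) (t : Fin (n + 1)),
        ∑ k with k ≤ t.castSucc, y k = ∑ k with k ≤ t, y k.castSucc := fun y t => by
      simp only [Finset.sum_filter, Fin.sum_univ_castSucc, Fin.castSucc_le_castSucc_iff]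
      simp [Fin.le_def, Nat.not_le_of_lt t.is_lt]
    have hlast : ∀ (y : Fin (n + 2) → Q → ZMod 2),
        ∑ k with k ≤ (Fin.last n).castSucc, y k = ∑ k : Fin (n + 1), y k.castSucc := fun y => by
      rw [hsum]
      congr 1
      ext k
      simp [Fin.le_last]
    rw [List.ofFn_succ', List.ofFn_succ', List.concat_eq_append, List.concat_eq_append,
      List.reverse_append, List.reverse_append, List.prod_append, List.prod_append,
      List.reverse_singleton, List.prod_singleton, List.reverse_singleton, List.prod_singleton,
      mul_assoc, he, hlast, hlast, Fin.sum_univ_castSucc x, Fin.sum_univ_castSucc z]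
    simp only [hsum]
    set xs := ∑ k : Fin (n + 1), x k.castSucc
    set zs := ∑ k : Fin (n + 1), z k.castSucc
    refine ⟨e + z (Fin.last n).succ ⬝ᵥ xs, ?_⟩
    rw [mul_smul_comm, mul_assoc, ← mul_assoc (T.syndromeProj _) (pauli xs zs),
      syndromeProj_mul_pauli, mul_assoc, ← mul_assoc (pauli _ _) (pauli xs zs), pauli_mul_pauli,
      smul_mul_assoc, smul_smul, ← sgn_add, add_comm xs, add_comm zs, Fin.succ_last]

/-- If the first round projects on states with syndrome `s₀`, the later rounds must repeat `s₀` and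
do not change the state. -/
theorem reverse_prod_mul_of_hasSyndrome {A M : Matrix (Q → ZMod 2) L ℂ} {s₀ : Syndrome X Z}
    (hA : T.syndromeProj s₀ * A = M) (hM : T.HasSyndrome s₀ M) {n : ℕ}
    {s : Fin (n + 1) → Syndrome X Z} (h0 : s 0 = s₀) [Decidable (∀ t, s t = s₀)] :
    (List.ofFn fun t => T.syndromeProj (s t)).reverse.prod * A =
      if ∀ t, s t = s₀ then M else 0 := by
  classical
  have hl : (List.ofFn fun t => T.syndromeProj (s t)) =
      T.syndromeProj (s 0) :: (List.ofFn fun t : Fin n => s t.succ).map T.syndromeProj := by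
    rw [List.ofFn_succ, List.map_ofFn]
    rfl
  rw [hl, List.reverse_cons, List.prod_append, List.prod_singleton, ← List.map_reverse,
    Matrix.mul_assoc, h0, hA]
  have key := list_prod_mul_eq_ite (List.ofFn fun t : Fin n => s t.succ).reverse
    (p := fun s' => s' = s₀) fun s' => hM.syndromeProj_mul s'
  rw [key]
  refine ite_congr ?_ (fun _ => rfl) fun _ => rfl
  simp [Fin.forall_fin_succ, h0, List.mem_ofFn]

end CSSCode

namespace Faults

variable {n : ℕ} {X Q Z : Type*}

/-- The product of the `X`-parts of the errors up to time `k`. -/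
def xSum (F : Faults n X Q Z) (k : Fin (n + 1)) : Q → ZMod 2 := ∑ t with t ≤ k, F.xErr t

/-- The product of the `Z`-parts of the errors up to time `k`. -/
def zSum (F : Faults n X Q Z) (k : Fin (n + 1)) : Q → ZMod 2 := ∑ t with t ≤ k, F.zErr t

theorem xSum_last (F : Faults n X Q Z) : F.xSum (Fin.last n) = ∑ t, F.xErr t := by
  simp [xSum, Fin.le_last]

theorem zSum_last (F : Faults n X Q Z) : F.zSum (Fin.last n) = ∑ t, F.zErr t := by
  simp [zSum, Fin.le_last]

variable [Fintype X] [Fintype Q] [Fintype Z]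

theorem weight_none : (none n X Q Z).weight = 0 := by
  simp [none, weight, pauliWeight]

theorem hammingNorm_xSum_le (F : Faults n X Q Z) (k : Fin (n + 1)) :
    hammingNorm (F.xSum k) ≤ F.weight :=
  (hammingNorm_left_le_pauliWeight _ (F.zSum k)).trans <|
    (pauliWeight_sum_le _ _ _).trans <|
      (Finset.sum_le_univ_sum_of_nonneg fun _ => Nat.zero_le _).trans (Nat.le_add_right _ _)

theorem hammingNorm_zSum_le (F : Faults n X Q Z) (k : Fin (n + 1)) :
    hammingNorm (F.zSum k) ≤ F.weight :=
  (hammingNorm_right_le_pauliWeight (F.xSum k) _).trans <|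
    (pauliWeight_sum_le _ _ _).trans <|
      (Finset.sum_le_univ_sum_of_nonneg fun _ => Nat.zero_le _).trans (Nat.le_add_right _ _)

/-- Discarding the `X`-parts of the errors up to time `k` leaves an error of weight at most the
number of faults. -/
theorem pauliWeight_xSum_add_le (F : Faults n X Q Z) (k : Fin (n + 1)) :
    pauliWeight (F.xSum (Fin.last n) + F.xSum k) (F.zSum (Fin.last n)) ≤ F.weight := by
  have hx : F.xSum (Fin.last n) + F.xSum k = ∑ t, if t ≤ k then 0 else F.xErr t := by
    rw [xSum_last, xSum, Finset.sum_filter, ← Finset.sum_add_distrib]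
    refine Finset.sum_congr rfl fun t _ => ?_
    split_ifs
    · exact ZModModule.add_self _
    · exact add_zero _
  rw [hx, zSum_last]
  refine (pauliWeight_sum_le _ _ _).trans ((Finset.sum_le_sum fun t _ => ?_).trans
    (Nat.le_add_right _ _))
  split_ifs
  · rw [pauliWeight_zero_left]
    exact hammingNorm_right_le_pauliWeight _ _
  · exact le_rfl

/-- If there are fewer faults than rounds, the outcomes of some round are recorded correctly. -/
theorem exists_flips_eq_zero (F F' : Faults n X Q Z) (h : F.weight + F'.weight < n) :
    ∃ t, F.flips t = 0 ∧ F'.flips t = 0 := by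
  by_contra! hne
  have h1 : ∀ t, 1 ≤ (hammingNorm (F.flips t).1 + hammingNorm (F.flips t).2) +
      (hammingNorm (F'.flips t).1 + hammingNorm (F'.flips t).2) := fun t => by
    rw [Nat.one_le_iff_ne_zero]
    intro h0
    simp only [Nat.add_eq_zero_iff, hammingNorm_eq_zero] at h0
    exact hne t (Prod.ext h0.1.1 h0.1.2) (Prod.ext h0.2.1 h0.2.2)
  have h2 := Finset.sum_le_sum fun t (_ : t ∈ Finset.univ) => h1 t
  rw [Finset.sum_add_distrib, Finset.sum_const, Finset.card_univ, Fintype.card_fin,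
    smul_eq_mul, mul_one] at h2
  simp only [weight] at h
  omega

end Faults

/-! ### Repeated measurement and fault tolerance -/

section Stabiliser

variable {Q L : Type*} [Fintype Q] [DecidableEq Q] {E : Matrix (Q → ZMod 2) L ℂ}

theorem pauli_mul_of_stabilises (x z : Q → ZMod 2) (hx : pauli x 0 * E = E)
    (hz : pauli 0 z * E = E) : pauli x z * E = E := by
  have : pauli x z = pauli x 0 * pauli 0 z := by
    rw [pauli_mul_pauli, zero_dotProduct, sgn_zero, one_smul, add_zero, zero_add]
  rw [this, Matrix.mul_assoc, hz, hx]

theorem pauli_add_mul_of_stabilises (x z : Q → ZMod 2) {y : Q → ZMod 2}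
    (hy : pauli y 0 * E = E) : pauli (x + y) z * E = sgn (z ⬝ᵥ y) • (pauli x z * E) := by
  have : pauli x z * E = pauli x z * (pauli y 0 * E) := by rw [hy]
  rw [this, ← Matrix.mul_assoc, pauli_mul_pauli, Matrix.smul_mul, smul_smul, sgn_mul_self,
    one_smul, add_zero]

end Stabiliser

/-- What a single faultless round of measurements of the checks of `T` does to the input states
`A`, and how `T` responds to errors on fewer than `d` qubits.  The possible records are indexed
by `P`. -/
structure RoundData {X Q Z L L' : Type*} [Fintype X] [Fintype Q] [Fintype Z] [DecidableEq Q]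
    [Fintype L'] (T : CSSCode X Q Z) (A : Matrix (Q → ZMod 2) L ℂ)
    (E : Matrix (Q → ZMod 2) L' ℂ) (ideal : ZMod 2 → Matrix L' L ℂ) (d : ℕ) (P : Type*)
    [Fintype P] where
  /-- the `X`-operator restoring the code space, the syndrome of which is the record -/
  shift : P → Q → ZMod 2
  /-- the logical measurement outcome -/
  outcome : P → ZMod 2
  /-- the common amplitude of the records -/
  amp : ℂ
  hasSyndrome : T.HasSyndrome 0 E
  shift_injective : Function.Injective fun p => T.PZ *ᵥ shift p
  proj_mul : ∀ p, T.syndromeProj (T.syndromeOf (shift p) 0) * A =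
    amp • (pauli (shift p) 0 * E * ideal (outcome p))
  proj_mul_eq_zero : ∀ s, (∀ p, s ≠ T.syndromeOf (shift p) 0) → T.syndromeProj s * A = 0
  amp_sum : ∀ c, (Finset.univ.filter fun p => outcome p = c).card * ‖amp‖ ^ 2 = 1
  /-- an `X`-error on fewer than `d` qubits can convert a record only into one with the same
  outcome, and is then undone by the operators restoring the code space -/
  x_trivial : ∀ p p' x, hammingNorm x < d → T.PZ *ᵥ (x + shift p + shift p') = 0 →
    outcome p = outcome p' ∧ pauli (x + shift p + shift p') 0 * E = E
  z_trivial : ∀ z, hammingNorm z < d → T.PX *ᵥ z = 0 → pauli 0 z * E = E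

namespace RoundData

variable {X Q Z L L' : Type*} [Fintype X] [Fintype Q] [Fintype Z] [DecidableEq Q]
  [Fintype L'] {T : CSSCode X Q Z} {A : Matrix (Q → ZMod 2) L ℂ}
  {E : Matrix (Q → ZMod 2) L' ℂ} {ideal : ZMod 2 → Matrix L' L ℂ} {d : ℕ} {P : Type*}
  [Fintype P] (D : RoundData T A E ideal d P)

/-- The recorded outcomes `o` can occur under the faults `F`, the first round of measurements
having projected on the record `p`. -/
def Consistent {n : ℕ} (F : Faults n X Q Z) (o : Fin n → Syndrome X Z) (p : P) : Prop :=
  ∀ t, o t + F.flips t + T.syndromeOf (F.xSum t.castSucc) (F.zSum t.castSucc) =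
    T.syndromeOf (D.shift p) 0

theorem syndrome_injective : Function.Injective fun p => T.syndromeOf (D.shift p) 0 :=
  fun _ _ h => D.shift_injective (congrArg Prod.snd h)

theorem consistent_none_iff {n : ℕ} {o : Fin n → Syndrome X Z} {p : P} :
    D.Consistent (Faults.none n X Q Z) o p ↔ ∀ t, o t = T.syndromeOf (D.shift p) 0 := by
  have hx : ∀ k, (Faults.none n X Q Z).xSum k = 0 := fun k => by simp [Faults.xSum, Faults.none]
  have hz : ∀ k, (Faults.none n X Q Z).zSum k = 0 := fun k => by simp [Faults.zSum, Faults.none]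
  have hf : ∀ t, (Faults.none n X Q Z).flips t = 0 := fun _ => rfl
  simp only [Consistent, hx, hz, hf, CSSCode.syndromeOf_zero, add_zero]

variable (T) in
/-- The operator of the measurement rounds with faults `F` and recorded outcomes `o`. -/
def rounds {n : ℕ} (F : Faults n X Q Z) (o : Fin n → Syndrome X Z) :
    Matrix (Q → ZMod 2) (Q → ZMod 2) ℂ :=
  (List.ofFn fun t : Fin n => pauli (F.xErr t.succ) (F.zErr t.succ) *
    T.syndromeProj (o t + F.flips t)).reverse.prod * pauli (F.xErr 0) (F.zErr 0)

theorem rounds_mul_of_consistent {n : ℕ} (hn : 0 < n) {F : Faults n X Q Z}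
    {o : Fin n → Syndrome X Z} {p : P} (h : D.Consistent F o p) :
    ∃ e : ZMod 2, rounds T F o * A = (sgn e * D.amp) •
      (pauli (F.xSum (Fin.last n) + D.shift p) (F.zSum (Fin.last n)) * E *
        ideal (D.outcome p)) := by
  classical
  obtain ⟨n, rfl⟩ := Nat.exists_eq_succ_of_ne_zero hn.ne'
  obtain ⟨e, he⟩ := T.exists_rounds_eq _ F.xErr F.zErr fun t => o t + F.flips t
  have hM : T.HasSyndrome (T.syndromeOf (D.shift p) 0)
      (D.amp • (pauli (D.shift p) 0 * E * ideal (D.outcome p))) := by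
    have := ((D.hasSyndrome.pauli_mul (D.shift p) 0).mul_right (ideal (D.outcome p))).smul D.amp
    rwa [zero_add] at this
  refine ⟨e + F.zSum (Fin.last _) ⬝ᵥ D.shift p, ?_⟩
  rw [rounds, he, Matrix.smul_mul, Matrix.mul_assoc,
    CSSCode.reverse_prod_mul_of_hasSyndrome (D.proj_mul p) hM (h 0), if_pos, Matrix.mul_smul,
    ← Matrix.mul_assoc, ← Matrix.mul_assoc, pauli_mul_pauli, Matrix.smul_mul, Matrix.smul_mul,
    smul_smul, smul_smul, add_zero, F.xSum_last, F.zSum_last, sgn_add]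
  · congr 1
    ring
  · exact h

theorem rounds_mul_of_not_consistent {n : ℕ} (hn : 0 < n) {F : Faults n X Q Z}
    {o : Fin n → Syndrome X Z} (h : ∀ p, ¬ D.Consistent F o p) : rounds T F o * A = 0 := by
  classical
  obtain ⟨n, rfl⟩ := Nat.exists_eq_succ_of_ne_zero hn.ne'
  obtain ⟨e, he⟩ := T.exists_rounds_eq _ F.xErr F.zErr fun t => o t + F.flips t
  rw [rounds, he, Matrix.smul_mul, Matrix.mul_assoc]
  set s : Fin (n + 1) → Syndrome X Z := fun t => o t + F.flips t + T.syndromeOf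
    (∑ k with k ≤ t.castSucc, F.xErr k) (∑ k with k ≤ t.castSucc, F.zErr k) with hs
  suffices (List.ofFn fun t => T.syndromeProj (s t)).reverse.prod * A = 0 by
    rw [this, Matrix.mul_zero, smul_zero]
  by_cases h0 : ∃ p, s 0 = T.syndromeOf (D.shift p) 0
  · obtain ⟨p, hp⟩ := h0
    have hM : T.HasSyndrome (T.syndromeOf (D.shift p) 0)
        (D.amp • (pauli (D.shift p) 0 * E * ideal (D.outcome p))) := by
      have := ((D.hasSyndrome.pauli_mul (D.shift p) 0).mul_right (ideal (D.outcome p))).smul D.amp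
      rwa [zero_add] at this
    rw [CSSCode.reverse_prod_mul_of_hasSyndrome (D.proj_mul p) hM hp, if_neg]
    exact h p
  · push Not at h0
    have hM : T.HasSyndrome (s 0) (0 : Matrix (Q → ZMod 2) L ℂ) :=
      ⟨fun a => by simp, fun b => by simp⟩
    rw [CSSCode.reverse_prod_mul_of_hasSyndrome (D.proj_mul_eq_zero _ h0) hM rfl, ite_self]

/-- If the same record is consistent with two fault patterns of total weight below the number of
rounds, then the errors before some round differ exactly by the change of the first record. -/
theorem exists_syndromeOf_eq {n : ℕ} {F F' : Faults n X Q Z} {o : Fin n → Syndrome X Z} {p p' : P}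
    (h : D.Consistent F o p) (h' : D.Consistent F' o p') (hw : F.weight + F'.weight < n) :
    ∃ k : Fin (n + 1), T.PZ *ᵥ (F.xSum k + F'.xSum k + D.shift p + D.shift p') = 0 := by
  obtain ⟨t, ht, ht'⟩ := F.exists_flips_eq_zero F' hw
  have e := congrArg Prod.snd (h t)
  have e' := congrArg Prod.snd (h' t)
  simp only [ht, ht', add_zero, Prod.snd_add, CSSCode.syndromeOf] at e e'
  refine ⟨t.castSucc, ?_⟩
  have key : ∀ a b c : Z → ZMod 2, b + c + (a + b) + (a + c) = 0 := fun a b c => by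
    rw [show b + c + (a + b) + (a + c) = (a + a) + (b + b) + (c + c) by abel,
      ZModModule.add_self, ZModModule.add_self, zero_add, zero_add, ZModModule.add_self]
  rw [Matrix.mulVec_add, Matrix.mulVec_add, Matrix.mulVec_add, ← e, ← e', key]

/-- Two explanations of a record by fewer than `d` faults in total agree on the outcome, and the
difference of their `X`-errors at some time acts trivially after restoration of the code space. -/
theorem outcome_eq {F F' : Faults d X Q Z} {o : Fin d → Syndrome X Z} {p p' : P}
    (h : D.Consistent F o p) (h' : D.Consistent F' o p') (hw : F.weight + F'.weight < d) :
    D.outcome p = D.outcome p' ∧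
      ∃ k, pauli (F.xSum k + F'.xSum k + D.shift p + D.shift p') 0 * E = E := by
  obtain ⟨k, hk⟩ := D.exists_syndromeOf_eq h h' hw
  have := D.x_trivial p p' (F.xSum k + F'.xSum k) ((hammingNorm_add_le.trans
    (add_le_add (F.hammingNorm_xSum_le k) (F'.hammingNorm_xSum_le k))).trans_lt hw) hk
  exact ⟨this.1, k, this.2⟩

open scoped Classical in
/-- The outcome belonging to some explanation of the record by fewer than `d / 2` faults. -/
def report (o : Fin d → Syndrome X Z) : ZMod 2 :=
  if h : ∃ Fp : Faults d X Q Z × P, 2 * Fp.1.weight < d ∧ D.Consistent Fp.1 o Fp.2 then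
    D.outcome h.choose.2
  else 0

theorem report_eq {F : Faults d X Q Z} {o : Fin d → Syndrome X Z} {p : P}
    (h : D.Consistent F o p) (hw : 2 * F.weight < d) : D.report o = D.outcome p := by
  have hex : ∃ Fp : Faults d X Q Z × P, 2 * Fp.1.weight < d ∧ D.Consistent Fp.1 o Fp.2 :=
    ⟨(F, p), hw, h⟩
  rw [report, dif_pos hex]
  exact (D.outcome_eq hex.choose_spec.2 h (by have := hex.choose_spec.1; omega)).1

theorem report_eq_of_consistent_none (hd : 0 < d) {o : Fin d → Syndrome X Z} {p : P}
    (h : D.Consistent (Faults.none d X Q Z) o p) : D.report o = D.outcome p :=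
  D.report_eq h (by rwa [Faults.weight_none, mul_zero])

open scoped Classical in
/-- The operator restoring the code space after the syndrome `s`. -/
def restore (s : Syndrome X Z) : Q → ZMod 2 :=
  if h : ∃ p, s = T.syndromeOf (D.shift p) 0 then D.shift h.choose else 0

theorem restore_eq (p : P) : D.restore (T.syndromeOf (D.shift p) 0) = D.shift p := by
  have h : ∃ p', T.syndromeOf (D.shift p) 0 = T.syndromeOf (D.shift p') 0 := ⟨p, rfl⟩
  rw [restore, dif_pos h, ← D.syndrome_injective h.choose_spec]

end RoundData

namespace RoundData

variable {X Q₀ B Z L L' : Type*} [Fintype X] [Fintype Q₀] [Fintype B] [Fintype Z]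
  [DecidableEq Q₀] [DecidableEq B] [Fintype L'] {T : CSSCode X (Q₀ ⊕ B) Z}
  {enc : Matrix (Q₀ → ZMod 2) L ℂ} {E : Matrix (Q₀ ⊕ B → ZMod 2) L' ℂ}
  {ideal : ZMod 2 → Matrix L' L ℂ} {d : ℕ} {P : Type*} [Fintype P]
  (D : RoundData T (plusPrep Q₀ B * enc) E ideal d P)

/-- The procedure that measures the checks in `d` rounds, reports the outcome of a likely
explanation of the record, and restores the code space according to the first round. -/
def procedure (hd : 0 < d) : Procedure X Q₀ B Z where
  code := T
  rounds := d
  report := D.report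
  correction o := (D.restore (o ⟨0, hd⟩), 0)

variable (hd : 0 < d)

theorem kraus_mul (F : Faults d X (Q₀ ⊕ B) Z) (o : Fin d → Syndrome X Z) :
    (D.procedure hd).kraus F o * enc =
      pauli (D.restore (o ⟨0, hd⟩)) 0 * (rounds T F o * (plusPrep Q₀ B * enc)) := by
  simp only [Procedure.kraus, rounds, Matrix.mul_assoc]
  rfl

theorem kraus_mul_of_not_consistent {F : Faults d X (Q₀ ⊕ B) Z} {o : Fin d → Syndrome X Z}
    (h : ∀ p, ¬ D.Consistent F o p) : (D.procedure hd).kraus F o * enc = 0 := by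
  rw [kraus_mul, D.rounds_mul_of_not_consistent hd h, Matrix.mul_zero]

theorem kraus_mul_of_consistent {F : Faults d X (Q₀ ⊕ B) Z} {o : Fin d → Syndrome X Z} {p : P}
    (h : D.Consistent F o p) : ∃ e : ZMod 2, (D.procedure hd).kraus F o * enc =
      (sgn e * D.amp) •
        (pauli (F.xSum (Fin.last d) + D.shift p + D.restore (o ⟨0, hd⟩)) (F.zSum (Fin.last d)) *
          E * ideal (D.outcome p)) := by
  obtain ⟨e, he⟩ := D.rounds_mul_of_consistent hd h
  refine ⟨e, ?_⟩
  rw [kraus_mul, he, Matrix.mul_smul, ← Matrix.mul_assoc, ← Matrix.mul_assoc, pauli_mul_pauli,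
    zero_dotProduct, sgn_zero, one_smul, zero_add, add_comm (D.restore _)]

theorem restore_of_consistent_none {o : Fin d → Syndrome X Z} {p : P}
    (h : D.Consistent (Faults.none d X (Q₀ ⊕ B) Z) o p) :
    D.restore (o ⟨0, hd⟩) = D.shift p := by
  rw [D.consistent_none_iff.1 h, D.restore_eq]

theorem implements : (D.procedure hd).Implements enc E ideal := by
  classical
  have hex : ∀ o : Fin d → Syndrome X Z, ∃ κ : ℂ,
      (D.procedure hd).kraus (Faults.none _ _ _ _) o * enc = κ • (E * ideal (D.report o)) ∧
      ((∀ p, ¬ D.Consistent (Faults.none d X (Q₀ ⊕ B) Z) o p) → κ = 0) ∧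
      ((∃ p, D.Consistent (Faults.none d X (Q₀ ⊕ B) Z) o p) → ‖κ‖ = ‖D.amp‖) := fun o => by
    by_cases h : ∃ p, D.Consistent (Faults.none d X (Q₀ ⊕ B) Z) o p
    · obtain ⟨p, hp⟩ := h
      obtain ⟨e, he⟩ := D.kraus_mul_of_consistent hd hp
      refine ⟨sgn e * D.amp, ?_, fun h => absurd hp (h p), fun _ => by simp⟩
      have hx : (Faults.none d X (Q₀ ⊕ B) Z).xSum (Fin.last d) = 0 := by
        simp [Faults.xSum, Faults.none]
      have hz : (Faults.none d X (Q₀ ⊕ B) Z).zSum (Fin.last d) = 0 := by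
        simp [Faults.zSum, Faults.none]
      refine he.trans ?_
      rw [hx, hz, zero_add, D.restore_of_consistent_none hd hp, ZModModule.add_self, pauli_zero,
        Matrix.one_mul, D.report_eq_of_consistent_none hd hp]
    · push Not at h
      refine ⟨0, ?_, fun _ => rfl, fun ⟨p, hp⟩ => absurd hp (h p)⟩
      rw [zero_smul]
      exact D.kraus_mul_of_not_consistent hd h
  choose κ hκ h0 h1 using hex
  refine ⟨κ, hκ, fun c => ?_⟩
  rw [← D.amp_sum c, ← nsmul_eq_mul, ← Finset.sum_const]
  symm
  refine Finset.sum_of_injOn (fun p (_ : Fin d) => T.syndromeOf (D.shift p) 0) ?_ ?_ ?_ ?_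
  · intro p _ p' _ h
    exact D.syndrome_injective (congrFun h ⟨0, hd⟩)
  · intro p hp
    simp only [Finset.coe_filter, Finset.mem_univ, true_and, Set.mem_ofPred_eq] at hp ⊢
    rw [← hp]
    exact D.report_eq_of_consistent_none hd (D.consistent_none_iff.2 fun _ => rfl)
  · intro o ho hno
    rw [h0 o, norm_zero, zero_pow two_ne_zero]
    intro p hp
    refine hno ⟨p, ?_, ?_⟩
    · simp only [Finset.coe_filter, Finset.mem_univ, true_and, Set.mem_ofPred_eq]
      rw [← D.report_eq_of_consistent_none hd hp]
      exact (Finset.mem_filter.1 ho).2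
    · exact funext fun t => (D.consistent_none_iff.1 hp t).symm
  · intro p _
    rw [h1 _ ⟨p, D.consistent_none_iff.2 fun _ => rfl⟩]

theorem detects : (D.procedure hd).Detects enc E ideal d := by
  intro (F : Faults d X (Q₀ ⊕ B) Z) hF (o : Fin d → Syndrome X Z) ho
  obtain ⟨p₀, h₀⟩ : ∃ p, D.Consistent (Faults.none d X (Q₀ ⊕ B) Z) o p := by
    by_contra! h
    exact ho (D.kraus_mul_of_not_consistent hd h)
  by_cases h : ∃ p, D.Consistent F o p
  · obtain ⟨p, hp⟩ := h
    obtain ⟨e, he⟩ := D.kraus_mul_of_consistent hd hp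
    obtain ⟨hout, k, hk⟩ := D.outcome_eq hp h₀ (by rwa [Faults.weight_none, add_zero])
    have hx : (Faults.none d X (Q₀ ⊕ B) Z).xSum k = 0 := by simp [Faults.xSum, Faults.none]
    rw [hx, add_zero] at hk
    -- only the `X`-errors after time `k` remain
    have he' := pauli_add_mul_of_stabilises (F.xSum (Fin.last d) + F.xSum k)
      (F.zSum (Fin.last d)) hk
    have key : ∀ a b c c' : Q₀ ⊕ B → ZMod 2, a + b + (b + c + c') = a + c + c' :=
      fun a b c c' => by
        rw [show a + b + (b + c + c') = a + c + c' + (b + b) by abel, ZModModule.add_self,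
          add_zero]
    rw [key] at he'
    refine ⟨F.xSum (Fin.last d) + F.xSum k, F.zSum (Fin.last d), 
      sgn e * D.amp * sgn (F.zSum (Fin.last d) ⬝ᵥ (F.xSum k + D.shift p + D.shift p₀)),
      F.pauliWeight_xSum_add_le k, ?_⟩
    refine he.trans ?_
    rw [D.restore_of_consistent_none hd h₀, he', Matrix.smul_mul, smul_smul, hout,
      ← D.report_eq_of_consistent_none hd h₀]
    rfl
  · push Not at h
    refine ⟨0, 0, 0, by simp [pauliWeight], ?_⟩
    rw [zero_smul]
    exact D.kraus_mul_of_not_consistent hd h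

theorem corrects : (D.procedure hd).Corrects enc E ideal d := by
  classical
  -- the error at the end of the procedure according to an explanation `(F, p)` of the record
  let err : (Fin d → Syndrome X Z) → Faults d X (Q₀ ⊕ B) Z × P →
      (Q₀ ⊕ B → ZMod 2) × (Q₀ ⊕ B → ZMod 2) := fun o Fp =>
    (Fp.1.xSum (Fin.last d) + D.shift Fp.2 + D.restore (o ⟨0, hd⟩), Fp.1.zSum (Fin.last d))
  let good : (Fin d → Syndrome X Z) → Syndrome X Z → Faults d X (Q₀ ⊕ B) Z × P → Prop :=
    fun o s Fp => 2 * Fp.1.weight < d ∧ D.Consistent Fp.1 o Fp.2 ∧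
      s = T.syndromeOf (err o Fp).1 (err o Fp).2
  refine ⟨fun o s => if h : ∃ Fp, good o s Fp then err o h.choose else 0, ?_⟩
  intro (F : Faults d X (Q₀ ⊕ B) Z) hF (o : Fin d → Syndrome X Z) s
  change 2 * F.weight < d at hF
  by_cases h : ∃ p, D.Consistent F o p
  swap
  · push Not at h
    refine ⟨0, ?_⟩
    rw [zero_smul, Matrix.mul_assoc]
    exact (congrArg _ (D.kraus_mul_of_not_consistent hd h)).trans (Matrix.mul_zero _)
  obtain ⟨p, hp⟩ := h
  obtain ⟨e, he⟩ := D.kraus_mul_of_consistent hd hp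
  have hM : T.HasSyndrome (T.syndromeOf (err o (F, p)).1 (err o (F, p)).2)
      ((D.procedure hd).kraus F o * enc) := by
    rw [he]
    have := ((D.hasSyndrome.pauli_mul (err o (F, p)).1 (err o (F, p)).2).mul_right
      (ideal (D.outcome p))).smul (sgn e * D.amp)
    rwa [zero_add] at this
  rw [Matrix.mul_assoc, Matrix.mul_assoc]
  rw [show (D.procedure hd).code = T from rfl, hM.syndromeProj_mul s]
  by_cases hs : s = T.syndromeOf (err o (F, p)).1 (err o (F, p)).2
  swap
  · refine ⟨0, ?_⟩
    rw [if_neg hs, Matrix.mul_zero, zero_smul]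
  rw [if_pos hs]
  have hex : ∃ Fp, good o s Fp := ⟨(F, p), hF, hp, hs⟩
  simp only [dif_pos hex]
  obtain ⟨hF', hp', hs'⟩ := hex.choose_spec
  generalize hex.choose = Fp at hF' hp' hs'
  obtain ⟨F', p'⟩ := Fp
  have hw : F.weight + F'.weight < d := by simp only at hF'; omega
  have hxe : (err o (F', p')).1 + (err o (F, p)).1 =
      F.xSum (Fin.last d) + F'.xSum (Fin.last d) + D.shift p + D.shift p' := by
    simp only [err]
    have key : ∀ a b c a' b' : Q₀ ⊕ B → ZMod 2,
        a + b + c + (a' + b' + c) = a' + a + b' + b := fun a b c a' b' => by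
      rw [show a + b + c + (a' + b' + c) = a' + a + b' + b + (c + c) by abel,
        ZModModule.add_self, add_zero]
    exact key _ _ _ _ _
  have hsyn := hs'.symm.trans hs
  have hx : pauli ((err o (F', p')).1 + (err o (F, p)).1) 0 * E = E := by
    rw [hxe]
    refine (D.x_trivial p p' _ ((hammingNorm_add_le.trans (add_le_add (F.hammingNorm_xSum_le _)
      (F'.hammingNorm_xSum_le _))).trans_lt hw) ?_).2
    rw [← hxe, Matrix.mulVec_add,
      show T.PZ *ᵥ (err o (F', p')).1 = T.PZ *ᵥ (err o (F, p)).1 from congrArg Prod.snd hsyn,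
      ZModModule.add_self]
  have hz : pauli 0 ((err o (F', p')).2 + (err o (F, p)).2) * E = E := by
    refine D.z_trivial _ ((hammingNorm_add_le.trans (add_le_add (F'.hammingNorm_zSum_le _)
      (F.hammingNorm_zSum_le _))).trans_lt (by rwa [add_comm])) ?_
    rw [Matrix.mulVec_add,
      show T.PX *ᵥ (err o (F', p')).2 = T.PX *ᵥ (err o (F, p)).2 from congrArg Prod.fst hsyn,
      ZModModule.add_self]
  refine ⟨sgn e * D.amp * sgn ((err o (F', p')).2 ⬝ᵥ (err o (F, p)).1), ?_⟩
  rw [he, Matrix.mul_smul, ← Matrix.mul_assoc, ← Matrix.mul_assoc]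
  rw [show pauli (F.xSum (Fin.last d) + D.shift p + D.restore (o ⟨0, hd⟩)) (F.zSum (Fin.last d)) =
    pauli (err o (F, p)).1 (err o (F, p)).2 from rfl, pauli_mul_pauli, Matrix.smul_mul,
    pauli_mul_of_stabilises _ _ hx hz, Matrix.smul_mul, smul_smul, ← D.report_eq hp hF]
  rfl

end RoundData

/-! ### Encoded states and the first round -/

namespace CSSCode

variable {X Q Z K : Type*} [Fintype Q] [Fintype Z] {C : CSSCode X Q Z}
  {b : Module.Basis K (ZMod 2) C.H0}

open scoped Classical in
theorem encoder_apply (q : Q → ZMod 2) (a : K → ZMod 2) :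
    C.encoder b q a =
      if q ∈ C.xClass b a then (((Real.sqrt ((C.xClass b a).ncard : ℝ))⁻¹ : ℝ) : ℂ) else 0 := rfl

theorem encoder_add_apply {x : Q → ZMod 2} (hx : x ∈ C.xClass b 0) (q : Q → ZMod 2)
    (a : K → ZMod 2) : C.encoder b (q + x) a = C.encoder b q a := by
  classical
  rw [encoder_apply, encoder_apply]
  refine if_congr ?_ rfl rfl
  conv_lhs => rw [← add_zero a]
  exact add_mem_xClass_iff hx

theorem row_mem_xClass_zero [Fintype X] (a : X) : C.PX a ∈ C.xClass b 0 :=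
  C.mem_xClass_zero_of_mem_dual_boundaries b (C.dual.row_mem_boundaries a)

variable [DecidableEq Q]

theorem pauli_mul_encoder_of_mem_xClass {x : Q → ZMod 2} (hx : x ∈ C.xClass b 0) :
    pauli x 0 * C.encoder b = C.encoder b := by
  ext q a
  rw [pauli_mul_apply, zero_dotProduct, sgn_zero, one_mul, encoder_add_apply hx]

theorem pauli_mul_encoder_of_mem_boundaries {z : Q → ZMod 2} (hz : z ∈ C.boundaries) :
    pauli 0 z * C.encoder b = C.encoder b := by
  ext q a
  rw [pauli_mul_apply, add_zero, encoder_apply]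
  split_ifs with hq
  · rw [C.dotProduct_eq_zero_of_mem_boundaries hz hq.1, sgn_zero, one_mul]
  · rw [mul_zero]

theorem hasSyndrome_encoder [Fintype X] : C.HasSyndrome 0 (C.encoder b) := by
  refine ⟨fun a => ?_, fun c => ?_⟩
  · rw [pauli_mul_encoder_of_mem_xClass (row_mem_xClass_zero a)]
    simp
  · rw [pauli_mul_encoder_of_mem_boundaries (C.row_mem_boundaries c)]
    simp

end CSSCode

theorem plusPrep_mul_apply {Q B L : Type*} [Fintype Q] [Fintype B] [DecidableEq Q]
    (M : Matrix (Q → ZMod 2) L ℂ) (q : Q ⊕ B → ZMod 2) (l : L) :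
    (plusPrep Q B * M) q l =
      (((Real.sqrt 2)⁻¹ ^ Fintype.card B : ℝ) : ℂ) * M (fun p => q (Sum.inl p)) l := by
  rw [Matrix.mul_apply]
  simp [plusPrep]

theorem pairEncoder_apply {QC QD KC KD : Type*} (eC : Matrix (QC → ZMod 2) (KC → ZMod 2) ℂ)
    (eD : Matrix (QD → ZMod 2) (KD → ZMod 2) ℂ) (q : QC ⊕ QD → ZMod 2) (a : KC ⊕ KD → ZMod 2) :
    pairEncoder eC eD q a =
      eC (fun p => q (Sum.inl p)) (fun k => a (Sum.inl k)) *
        eD (fun p => q (Sum.inr p)) (fun k => a (Sum.inr k)) := rfl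

namespace Sandwich

theorem mul_zzBranch_apply {KC KD N : Type*} [Fintype KC] [Fintype KD] [DecidableEq KC]
    [DecidableEq KD] {i : KC} {j : KD} (E : Matrix N (KC ⊕ {l : KD // l ≠ j} → ZMod 2) ℂ)
    (c : ZMod 2) (q : N) (a : KC ⊕ KD → ZMod 2) :
    (E * zzBranch i j c) q a = if a (Sum.inl i) + a (Sum.inr j) = c then
      E q (mergedLabel j ((fun k => a (Sum.inl k)) + c • Pi.single i 1) fun l => a (Sum.inr l))
      else 0 := by
  rw [Matrix.mul_apply]
  simp only [zzBranch, Matrix.of_apply, mul_ite, mul_one, mul_zero, ite_and]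
  split_ifs with hc
  · rw [Finset.sum_eq_single
      (mergedLabel j ((fun k => a (Sum.inl k)) + c • Pi.single i 1) fun l => a (Sum.inr l))]
    · rw [if_pos, if_pos]
      · intro l; rfl
      · intro l; simp [mergedLabel, Pi.single_apply]
    · intro t _ ht
      rw [← ite_and, if_neg]
      rintro ⟨h1, h2⟩
      refine ht (funext ?_)
      rintro (k | l)
      · simpa [mergedLabel, Pi.single_apply] using h1 k
      · exact h2 l
    · exact fun h => absurd (Finset.mem_univ _) h
  · simp

/-- There are `2 ^ |R|` equally likely records for each outcome. -/
theorem card_mul_norm_amp_sq {R : Type*} [Fintype R] [DecidableEq R] (c : ZMod 2) :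
    ((Finset.univ.filter fun p : ZMod 2 × (R → ZMod 2) => p.1 = c).card : ℝ) *
      ‖(((Real.sqrt 2)⁻¹ ^ Fintype.card R : ℝ) : ℂ)‖ ^ 2 = 1 := by
  have h : (Finset.univ.filter fun p : ZMod 2 × (R → ZMod 2) => p.1 = c) =
      {c} ×ˢ Finset.univ := by
    ext p
    simp [Prod.ext_iff, eq_comm]
  rw [h, Finset.card_product, Finset.card_singleton, one_mul, Finset.card_univ, Fintype.card_fun,
    ZMod.card, Complex.norm_real, norm_pow, ← pow_mul, mul_comm _ 2, pow_mul, norm_inv, inv_pow,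
    Real.norm_eq_abs, sq_abs, Real.sq_sqrt zero_le_two, Nat.cast_pow, ← mul_pow]
  norm_num

section Bits

variable {QC QD R : Type*}

theorem elim_elim_eta (q : (QC ⊕ QD) ⊕ R → ZMod 2) :
    Sum.elim (Sum.elim (fun p => q (Sum.inl (Sum.inl p))) fun p => q (Sum.inl (Sum.inr p)))
      (fun p => q (Sum.inr p)) = q := by
  ext ((_ | _) | _) <;> rfl

/-- The `X`-operator `X̄ᵢᶜ X^τ` that restores the code space of `T`. -/
def shift (x₀ : QC → ZMod 2) (p : ZMod 2 × (R → ZMod 2)) : (QC ⊕ QD) ⊕ R → ZMod 2 :=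
  Sum.elim (Sum.elim (p.1 • x₀) 0) p.2

theorem add_shift (x₀ : QC → ZMod 2) (p : ZMod 2 × (R → ZMod 2)) (q : QC → ZMod 2)
    (q' : QD → ZMod 2) (t : R → ZMod 2) :
    Sum.elim (Sum.elim q q') t + shift x₀ p = Sum.elim (Sum.elim (q + p.1 • x₀) q') (t + p.2) := by
  ext ((_ | _) | _) <;> simp [shift]

end Bits

variable {XC QC ZC XD QD ZD R M KC KD : Type*}
  [Fintype XC] [Fintype QC] [Fintype ZC] [Fintype XD] [Fintype QD] [Fintype ZD]
  [Fintype R] [Fintype M] [DecidableEq QC] [DecidableEq QD]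
  {C : CSSCode XC QC ZC} {D : CSSCode XD QD ZD} {dV : Matrix R M (ZMod 2)}
  {S : LogicalSubcomplex C dV} {S' : LogicalSubcomplex D dV}
  {bC : Module.Basis KC (ZMod 2) C.H0} {bD : Module.Basis KD (ZMod 2) D.H0}
  {i : KC} {j : KD}

/-- The input states with the fresh qubits are invariant under the `X`-checks of `T`. -/
theorem pauli_PX_mul_input [DecidableEq R] (S : LogicalSubcomplex C dV) (S' : LogicalSubcomplex D dV)
    (x : XC ⊕ XD) : pauli ((sandwich S S').PX x) 0 *
      (plusPrep (QC ⊕ QD) R * pairEncoder (C.encoder bC) (D.encoder bD)) =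
        plusPrep (QC ⊕ QD) R * pairEncoder (C.encoder bC) (D.encoder bD) := by
  ext q a
  rw [pauli_mul_apply, zero_dotProduct, sgn_zero, one_mul, plusPrep_mul_apply, plusPrep_mul_apply,
    pairEncoder_apply, pairEncoder_apply]
  have h0 : (0 : QC → ZMod 2) ∈ C.xClass bC 0 := ⟨zero_mem _, fun _ _ _ => by simp⟩
  have h0' : (0 : QD → ZMod 2) ∈ D.xClass bD 0 := ⟨zero_mem _, fun _ _ _ => by simp⟩
  rcases x with x | x
  · exact congrArg _ (congrArg₂ _ (CSSCode.encoder_add_apply (CSSCode.row_mem_xClass_zero x) _ _)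
      (CSSCode.encoder_add_apply h0' _ _))
  · exact congrArg _ (congrArg₂ _ (CSSCode.encoder_add_apply h0 _ _)
      (CSSCode.encoder_add_apply (CSSCode.row_mem_xClass_zero x) _ _))

variable [DecidableEq KC]

theorem PZ_mulVec_shift_injective {x₀ : QC → ZMod 2} (hsep : Separated bC bD i j S S')
    (hx : x₀ ∈ C.xClass bC (Pi.single i 1)) :
    Function.Injective fun p => (sandwich S S').PZ *ᵥ shift x₀ p := by
  rintro ⟨c, τ⟩ ⟨c', τ'⟩ h
  simp only [shift, PZ_mulVec, Sum.elim_eq_iff, Matrix.mulVec_zero, add_zero] at h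
  have h2 := h.2
  have hc : c = c' := by
    have := congrArg (fun w => 1 ⬝ᵥ w) h2
    simpa [dotProduct_add, Matrix.dotProduct_transpose_mulVec', S.differential_mulVec_one,
      S.incl₀_mulVec_one, hx.2 _ _ hsep.class_left] using this
  subst hc
  rw [Matrix.transpose_mulVec_injective_of_range_eq_top dV S.surjective (add_left_cancel h2)]

theorem syndromeProj_mul_input_eq_zero [DecidableEq R] {x₀ : QC → ZMod 2} (hsep : Separated bC bD i j S S')
    (hx : x₀ ∈ C.xClass bC (Pi.single i 1)) {s : Syndrome (XC ⊕ XD) ((ZC ⊕ ZD) ⊕ M)}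
    (hs : ∀ p, s ≠ (sandwich S S').syndromeOf (shift x₀ p) 0) :
    (sandwich S S').syndromeProj s *
      (plusPrep (QC ⊕ QD) R * pairEncoder (C.encoder bC) (D.encoder bD)) = 0 := by
  classical
  ext q a
  rw [(sandwich S S').syndromeProj_mul_apply (pauli_PX_mul_input S S'), plusPrep_mul_apply,
    pairEncoder_apply, CSSCode.encoder_apply, CSSCode.encoder_apply, Matrix.zero_apply]
  split_ifs with h h1 h2 h2
  · exfalso
    obtain ⟨q₁, q₂, t, rfl⟩ : ∃ q₁ q₂ t, q = Sum.elim (Sum.elim q₁ q₂) t :=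
      ⟨_, _, _, (elim_elim_eta q).symm⟩
    simp only [Sum.elim_inl, Sum.elim_inr] at h1 h2
    set c := a (Sum.inl i) + a (Sum.inr j) with hc
    obtain ⟨t', ht'⟩ := exists_transpose_mulVec_eq hsep (by
      simp [hc, ← add_assoc, CharTwo.add_self_eq_zero])
      (CSSCode.add_mem_xClass h1 (CSSCode.smul_mem_xClass hx c)) h2
    refine hs (c, t + t') (Prod.ext (by simpa [CSSCode.syndromeOf] using h.1) ?_)
    have hmem : Sum.elim (Sum.elim q₁ q₂) t + shift x₀ (c, t + t') ∈
        (sandwich S S').dual.cycles := by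
      rw [add_shift, elim_mem_dual_cycles_iff, ← add_assoc, ZModModule.add_self, zero_add]
      exact ⟨add_mem h1.1 (Submodule.smul_mem _ _ hx.1), h2.1, ht'⟩
    rw [CSSCode.mem_dual_cycles, Matrix.mulVec_add, ← ZModModule.sub_eq_add, sub_eq_zero] at hmem
    exact h.2.symm.trans hmem
  all_goals simp

variable [Fintype KC] [Fintype KD] [DecidableEq KD]

theorem x_trivial {x₀ : QC → ZMod 2} (hsep : Separated bC bD i j S S')
    (hx₀ : x₀ ∈ C.xClass bC (Pi.single i 1)) (p p' : ZMod 2 × (R → ZMod 2))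
    {x : (QC ⊕ QD) ⊕ R → ZMod 2} (hx : hammingNorm x < (C.directSum D).distance)
    (hZ : (sandwich S S').PZ *ᵥ (x + shift x₀ p + shift x₀ p') = 0) :
    p.1 = p'.1 ∧ x + shift x₀ p + shift x₀ p' ∈
      (sandwich S S').xClass (homologyBasis hsep) 0 := by
  obtain ⟨q, q', t, rfl⟩ : ∃ q₁ q₂ t, x = Sum.elim (Sum.elim q₁ q₂) t :=
    ⟨_, _, _, (elim_elim_eta x).symm⟩
  rw [← CSSCode.mem_dual_cycles, add_shift, add_shift, elim_mem_dual_cycles_iff] at hZ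
  obtain ⟨hq, hq', ht⟩ := hZ
  have hq : q ∈ C.dual.cycles := by
    rwa [Submodule.add_mem_iff_left _ (Submodule.smul_mem _ _ hx₀.1),
      Submodule.add_mem_iff_left _ (Submodule.smul_mem _ _ hx₀.1)] at hq
  obtain ⟨h1, h2⟩ := C.mem_xClass_zero_of_lt_distance bC D bD hq hq'
    ((hammingNorm_comp_le_of_injective (Sum.elim (Sum.elim q q') t)
      Sum.inl_injective).trans_lt hx)
  have h3 := CSSCode.add_mem_xClass (CSSCode.add_mem_xClass h1
    (CSSCode.smul_mem_xClass hx₀ p.1)) (CSSCode.smul_mem_xClass hx₀ p'.1)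
  obtain ⟨h4, h5⟩ := (elim_mem_xClass_iff hsep).2 ⟨h3, h2, ht⟩
  have hp : p.1 = p'.1 := by
    simpa [CharTwo.add_eq_zero] using h4
  refine ⟨hp, ?_⟩
  rw [add_shift, add_shift]
  convert h5
  rw [hp, add_assoc, ZModModule.add_self, add_zero]
  ext (_ | _) <;> rfl

variable [DecidableEq R]

theorem syndromeProj_mul_input {x₀ : QC → ZMod 2} (hsep : Separated bC bD i j S S')
    (hx : x₀ ∈ C.xClass bC (Pi.single i 1)) (p : ZMod 2 × (R → ZMod 2)) :
    (sandwich S S').syndromeProj ((sandwich S S').syndromeOf (shift x₀ p) 0) *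
        (plusPrep (QC ⊕ QD) R * pairEncoder (C.encoder bC) (D.encoder bD)) =
      (((Real.sqrt 2)⁻¹ ^ Fintype.card R : ℝ) : ℂ) •
        (pauli (shift (QD := QD) x₀ p) 0 * (sandwich S S').encoder (homologyBasis hsep) *
          zzBranch i j p.1) := by
  classical
  ext q a
  rw [(sandwich S S').syndromeProj_mul_apply (pauli_PX_mul_input S S'), plusPrep_mul_apply,
    Matrix.smul_apply, Matrix.mul_assoc, pauli_mul_apply, zero_dotProduct, sgn_zero, one_mul,
    mul_zzBranch_apply, smul_eq_mul, ← mul_ite_zero, pairEncoder_apply]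
  congr 1
  have hpar : a (Sum.inl i) + a (Sum.inr j) = p.1 ↔
      ((fun k => a (Sum.inl k)) + p.1 • Pi.single i 1 : KC → ZMod 2) i =
        (fun l => a (Sum.inr l)) j := by
    simp only [Pi.add_apply, Pi.smul_apply, Pi.single_eq_same, smul_eq_mul, mul_one]
    generalize a (Sum.inl i) = r
    generalize a (Sum.inr j) = s
    generalize p.1 = c
    revert r s c
    decide
  have hsyn : ((sandwich S S').syndromeOf (shift x₀ p) 0).1 = 0 ∧
      (sandwich S S').PZ *ᵥ q = ((sandwich S S').syndromeOf (shift x₀ p) 0).2 ↔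
        q + shift x₀ p ∈ (sandwich S S').dual.cycles := by
    rw [CSSCode.mem_dual_cycles, Matrix.mulVec_add, ← ZModModule.sub_eq_add, sub_eq_zero]
    simp [CSSCode.syndromeOf]
  obtain ⟨q₁, q₂, t, rfl⟩ : ∃ q₁ q₂ t, q = Sum.elim (Sum.elim q₁ q₂) t :=
    ⟨_, _, _, (elim_elim_eta q).symm⟩
  rw [add_shift, elim_mem_dual_cycles_iff] at hsyn
  have hmem := elim_mem_xClass_iff hsep (q := q₁ + p.1 • x₀) (q' := q₂) (t := t + p.2)
    (a := (fun k => a (Sum.inl k)) + p.1 • Pi.single i 1) (b := fun l => a (Sum.inr l))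
  rw [← hpar, CSSCode.add_mem_xClass_iff (CSSCode.smul_mem_xClass hx p.1)] at hmem
  simp only [Sum.elim_inl, Sum.elim_inr, CSSCode.encoder_apply, hsyn, add_shift]
  by_cases hall : q₁ ∈ C.xClass bC (fun k => a (Sum.inl k)) ∧
      q₂ ∈ D.xClass bD (fun l => a (Sum.inr l)) ∧
        dVᵀ *ᵥ (t + p.2) = S.incl₀ᵀ *ᵥ (q₁ + p.1 • x₀) + S'.incl₀ᵀ *ᵥ q₂
  · have h2 := hmem.2 hall
    have hcyc : q₁ + p.1 • x₀ ∈ C.dual.cycles :=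
      add_mem hall.1.1 (Submodule.smul_mem _ _ hx.1)
    rw [if_pos ⟨hcyc, hall.2.1.1, hall.2.2⟩, if_pos hall.1, if_pos hall.2.1, if_pos h2.1,
      if_pos h2.2, ncard_xClass hsep (hpar.1 h2.1),
      C.ncard_xClass_add bC (CSSCode.smul_mem_xClass hx p.1), Nat.cast_mul,
      Real.sqrt_mul (Nat.cast_nonneg _), mul_inv, Complex.ofReal_mul]
  · rw [← ite_and, if_neg (fun h => hall (hmem.1 h))]
    split_ifs with h1 h2 h3
    · exact absurd ⟨h2, h3, h1.2.2⟩ hall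
    · exact mul_zero _
    · exact zero_mul _
    · exact zero_mul _
    · rfl

/-- The first round of the merging procedure. -/
def roundData {x₀ : QC → ZMod 2} (hsep : Separated bC bD i j S S')
    (hx₀ : x₀ ∈ C.xClass bC (Pi.single i 1))
    (hT : ∀ z, (sandwich S S').IsLogicalZ z → (C.directSum D).distance ≤ hammingNorm z) :
    RoundData (sandwich S S')
      (plusPrep (QC ⊕ QD) R * pairEncoder (C.encoder bC) (D.encoder bD))
      ((sandwich S S').encoder (homologyBasis hsep)) (zzBranch i j) (C.directSum D).distance
      (ZMod 2 × (R → ZMod 2)) where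
  shift := shift x₀
  outcome := Prod.fst
  amp := (((Real.sqrt 2)⁻¹ ^ Fintype.card R : ℝ) : ℂ)
  hasSyndrome := CSSCode.hasSyndrome_encoder
  shift_injective := PZ_mulVec_shift_injective hsep hx₀
  proj_mul := syndromeProj_mul_input hsep hx₀
  proj_mul_eq_zero _ := syndromeProj_mul_input_eq_zero hsep hx₀
  amp_sum := card_mul_norm_amp_sq
  x_trivial p p' x hx hZ :=
    ⟨(x_trivial hsep hx₀ p p' hx hZ).1,
      CSSCode.pauli_mul_encoder_of_mem_xClass (x_trivial hsep hx₀ p p' hx hZ).2⟩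
  z_trivial z hz hX := CSSCode.pauli_mul_encoder_of_mem_boundaries (by
    by_contra h
    exact absurd (hT z ⟨CSSCode.mem_cycles.2 hX, h⟩) (not_le.2 hz))

end Sandwich

end

theorem mainTheorem1 {XC QC ZC XD QD ZD KC KD : Type*}
    [Fintype XC] [Fintype QC] [Fintype ZC] [Fintype XD] [Fintype QD] [Fintype ZD]
    [Fintype KC] [Fintype KD] [DecidableEq QC] [DecidableEq QD] [DecidableEq KC] [DecidableEq KD]
    (C : CSSCode XC QC ZC) (D : CSSCode XD QD ZD)
    (bC : Module.Basis KC (ZMod 2) C.H0) (bD : Module.Basis KD (ZMod 2) D.H0) (i : KC) (j : KD)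
    (m r : ℕ) (dV : Matrix (Fin r) (Fin m) (ZMod 2))
    (S : LogicalSubcomplex C dV) (S' : LogicalSubcomplex D dV)
    (hsep : Separated bC bD i j S S')
    (hgC : S.GaugeFixable bC i) (hgD : S'.GaugeFixable bD j)
    (d : ℕ) (hd : d = (C.directSum D).distance)
    (hT : ∀ z, (sandwich S S').IsLogicalZ z → d ≤ hammingNorm z) :
    d ≤ (sandwich S S').distance ∧
    ∃ bT : Module.Basis (KC ⊕ {l : KD // l ≠ j}) (ZMod 2) (sandwich S S').H0,
      (∀ l z, C.Represents z (bC l) →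
        (sandwich S S').Represents (Sum.elim (Sum.elim z 0) 0) (bT (Sum.inl l))) ∧
      (∀ (l : {l : KD // l ≠ j}) z, D.Represents z (bD l) →
        (sandwich S S').Represents (Sum.elim (Sum.elim 0 z) 0) (bT (Sum.inr l))) ∧
      (∀ z, D.Represents z (bD j) →
        (sandwich S S').Represents (Sum.elim (Sum.elim 0 z) 0) (bT (Sum.inl i))) ∧
      ∃ P : Procedure (XC ⊕ XD) (QC ⊕ QD) (Fin r) ((ZC ⊕ ZD) ⊕ Fin m),
        P.code = sandwich S S' ∧
        P.rounds = d ∧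
        P.Implements (pairEncoder (C.encoder bC) (D.encoder bD)) ((sandwich S S').encoder bT)
          (zzBranch i j) ∧
        P.FaultTolerant (pairEncoder (C.encoder bC) (D.encoder bD)) ((sandwich S S').encoder bT)
          (zzBranch i j) d := by
  subst hd
  obtain ⟨p, hp⟩ := S.exists_op_ne_zero
  obtain ⟨x₀, hx₀, -⟩ := hgC p hp
  have hpos : 0 < (C.directSum D).distance :=
    (C.directSum D).distance_pos (C.directSum_isLogicalZ_inl D S.isLogicalZ)
  have hne : ∃ z, (sandwich S S').IsLogicalZ z := by
    obtain ⟨z, hz⟩ := (sandwich S S').exists_represents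
      (Sandwich.homologyBasis hsep (Sum.inl i))
    refine ⟨z, hz.1, fun hb => ?_⟩
    obtain ⟨hc, e⟩ := CSSCode.represents_iff.1 hz
    exact (Sandwich.homologyBasis hsep).ne_zero (Sum.inl i)
      (e.symm.trans (CSSCode.homologyClass_eq_zero.2 hb))
  let R := Sandwich.roundData hsep hx₀ hT
  refine ⟨CSSCode.le_distance _ ?_ hne, Sandwich.homologyBasis hsep, ?_, ?_, ?_,
    R.procedure hpos, rfl, rfl, R.implements hpos, R.detects hpos, R.corrects hpos⟩
  · rintro v (hv | hv)
    · exact hT v hv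
    · exact Sandwich.distance_le_hammingNorm S S' hv
  · intro l z hz
    rw [Sandwich.homologyBasis_inl]
    exact Sandwich.represents_homologyInl hz
  · intro l z hz
    rw [Sandwich.homologyBasis_inr]
    exact Sandwich.represents_homologyInr hz
  · intro z hz
    rw [Sandwich.homologyBasis_inl, ← Sandwich.homologyInr_eq_homologyInl hsep]
    exact Sandwich.represents_homologyInr hz
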